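/- A *closure space* is a set $X$ with a map $c:\mathcal P(X)\to\mathcal P(X)$ such that $c(\emptyset)=\emptyset$, $A\subseteq c(A)$ and $c(A\cup B)=c(A)\cup c(B)$ for all $A,B\subseteq X$; its interior operation is $i(A)=X\setminus c(X\setminus A)$, and $V$ is a neighborhood of $x$ if $x\in i(V)$. A map $f:(X,c)\to(Y,d)$ is *continuous* if $f(c(A))\subseteq d(f(A))$ for all $A\subseteq X$. An *interior cover* of $X$ is a family $\mathcal U=\{U_j\}$ of subsets of $X$ with $X=\bigcup_j i(U_j)$. Let $J\in\{I,J_+,J_1\}$, where $I=[0,1]$ has the closure operation of its usual topology, $J_+=\{0,1\}$ with $c(\{0\})=\{0,1\}$, $c(\{1\})=\{1\}$, and $J_1=\{0,1\}$ with $c(\{0\})=c(\{1\})=\{0,1\}$. Let $|\Delta^n|^{J}$ be the standard topological $n$-simplex if $J=I$; the set $\{0,\dots,n\}$ with $c(A)=\{j : \exists\, i\in A,\ i\le j\}$ if $J=J_+$; and $\{0,\dots,n\}$ with the indiscrete closure if $J=J_1$. Let $J^{\times n}$ be the $n$-fold product of $J$ with the product closure (the finite intersections of preimages of coordinate neighborhoods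 form a local base at each point); $J^{\times 0}$ is a point. For a closure space $X$, let $C^{J}_\bullet(X)$ be the chain complex in which $C^J_n(X)$ is the free abelian group on the continuous maps $\sigma:|\Delta^n|^J\to X$, with $\partial\sigma=\sum_{i=0}^n(-1)^i d_i\sigma$, where $d_i\sigma$ is the restriction of $\sigma$ to the $i$-th face. Let $C^{(J,\times)}_\bullet(X)$ be the chain complex in which $C^{(J,\times)}_n(X)$ is the free abelian group on the continuous maps $\sigma:J^{\times n}\to X$ modulo the subgroup generated by the degenerate ones, those which do not depend on some coordinate, with $\partial\sigma=\sum_{i=1}^n(-1)^i(A_i\sigma-B_i\sigma)$, where $A_i\sigma$ and $B_i\sigma$ are the restrictions of $\sigma$ to the faces on which the $i$-th coordinate is $0$ and $1$, respectively. Let $\mathcal U$ be an interior cover of $X$, and let $C^{J}_\bullet(X)^{\mathcal U}\subseteq C^{J}_\bullet(X)$ and $C^{(J,\times)}_\bullet(X)^{\mathcal U}\subseteq C^{(J,\times)}_\bullet(X)$ be the subcomplexes generated by those $\sigma$ whose image is contained in some $U\in\mathcal U$. **Proposition.** For every $J\in\{I,J_+,J_1\}$ the inclusions $C^{J}_\bullet(X)^{\mathcal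 U}\hookrightarrow C^{J}_\bullet(X)$ and $C^{(J,\times)}_\bullet(X)^{\mathcal U}\hookrightarrow C^{(J,\times)}_\bullet(X)$ are chain homotopy equivalences. In particular $C^{J}_\bullet(X)^{\mathcal U}$ is chain homotopy equivalent to $C^{J}_\bullet(X)$, and $C^{(J,\times)}_\bullet(X)^{\mathcal U}$ is chain homotopy equivalent to $C^{(J,\times)}_\bullet(X)$. Furthermore, if $J\in\{J_1,J_+\}$, then $C^{J}_\bullet(X)^{\mathcal U}=C^{J}_\bullet(X)$ and $C^{(J,\times)}_\bullet(X)^{\mathcal U}=C^{(J,\times)}_\bullet(X)$. -/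

import Mathlib

universe u v w

namespace CechClosure

open CategoryTheory Set

/-! ### Closure spaces, interiors, continuous maps -/

/-- A Čech closure operation on `X` (not assumed to be idempotent). -/
class ClosureSpace (X : Type u) where
  /-- the closure of a subset -/
  cl : Set X → Set X
  cl_empty : cl ∅ = ∅
  subset_cl : ∀ A : Set X, A ⊆ cl A
  cl_union : ∀ A B : Set X, cl (A ∪ B) = cl A ∪ cl B

namespace ClosureSpace

/-- The interior operation `i(A) = X - c(X - A)`. -/
def intr {X : Type u} [ClosureSpace X] (A : Set X) : Set X := (cl Aᶜ)ᶜ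

lemma cl_mono {X : Type u} [ClosureSpace X] {A B : Set X} (h : A ⊆ B) : cl A ⊆ cl B := by
  rw [← union_eq_self_of_subset_left h, cl_union]
  exact subset_union_left

/-- The filter of neighborhoods of a point: `V` is a neighborhood of `x` iff `x ∈ i(V)`. -/
def nhd {X : Type u} [ClosureSpace X] (x : X) : Filter X where
  sets := {V | x ∈ intr V}
  univ_sets := by simp [intr, cl_empty]
  sets_of_superset := by
    intro A B hA h hB
    exact hA (cl_mono (compl_subset_compl.2 h) hB)
  inter_sets := by
    intro A B hA hB h
    rw [compl_inter, cl_union] at h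
    exact h.elim hA hB

lemma mem_cl_iff {X : Type u} [ClosureSpace X] {x : X} {A : Set X} :
    x ∈ cl A ↔ ∃ᶠ y in nhd x, y ∈ A := by
  have : (∀ᶠ y in nhd x, y ∉ A) ↔ x ∉ cl A := by
    change x ∈ (cl (Aᶜ)ᶜ)ᶜ ↔ _
    rw [compl_compl]
    rfl
  rw [Filter.Frequently, this, not_not]

/-- The (topological) closure operation of a topological space. -/
@[reducible] def ofTopology (X : Type u) [TopologicalSpace X] : ClosureSpace X where
  cl := closure
  cl_empty := closure_empty
  subset_cl := fun _ => subset_closure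
  cl_union := fun _ _ => closure_union

/-- The closure operation of a reflexive relation: `c(A) = {j | ∃ i ∈ A, r i j}`. -/
@[reducible] def ofRel {X : Type u} (r : X → X → Prop) (hr : ∀ x, r x x) : ClosureSpace X where
  cl A := {j | ∃ i ∈ A, r i j}
  cl_empty := by simp
  subset_cl := fun _ x hx => ⟨x, hx, hr x⟩
  cl_union := by
    intro A B
    ext x
    constructor
    · rintro ⟨i, hi | hi, h⟩
      · exact Or.inl ⟨i, hi, h⟩
      · exact Or.inr ⟨i, hi, h⟩
    · rintro (⟨i, hi, h⟩ | ⟨i, hi, h⟩)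
      · exact ⟨i, Or.inl hi, h⟩
      · exact ⟨i, Or.inr hi, h⟩

/-- The product closure. The finite intersections of sets `π_α ⁻¹ (V_α)`, with `V_α` a neighborhood
of `x α`, are a base of the filter `Filter.pi`, and they form a local base at `x`. -/
instance pi {α : Type u} {X : α → Type v} [∀ a, ClosureSpace (X a)] :
    ClosureSpace (∀ a, X a) where
  cl A := {x | ∃ᶠ y in Filter.pi (fun a => nhd (x a)), y ∈ A}
  cl_empty := by simp
  subset_cl := by
    intro A x hx hn
    refine (?_ : ∀ V ∈ Filter.pi (fun a => nhd (x a)), x ∈ V) _ hn hx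
    intro V hV
    have hp : pure x ≤ Filter.pi (fun a => nhd (x a)) := by
      refine Filter.le_pi.2 fun a => ?_
      intro W hW
      by_contra hx'
      exact hW (subset_cl _ hx')
    exact hp hV
  cl_union := by
    intro A B
    ext x
    exact Filter.frequently_or_distrib

/-- Every point has a neighborhood among the `U j`. -/
def IsInteriorCover {X : Type u} [ClosureSpace X] {ι : Type v} (U : ι → Set X) : Prop :=
  ⋃ j, intr (U j) = univ

/-- Continuity of maps of closure spaces: `f(c(A)) ⊆ d(f(A))` for all `A`. -/
def IsCont {X : Type u} {Y : Type v} [ClosureSpace X] [ClosureSpace Y] (f : X → Y) : Prop :=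
  ∀ A : Set X, f '' cl A ⊆ cl (f '' A)

lemma isCont_iff_tendsto {X : Type u} {Y : Type v} [ClosureSpace X] [ClosureSpace Y]
    {f : X → Y} : IsCont f ↔ ∀ x, Filter.Tendsto f (nhd x) (nhd (f x)) := by
  constructor
  · intro h x V hV
    change x ∉ cl (f ⁻¹' V)ᶜ
    intro hx
    apply hV
    refine cl_mono ?_ (h _ (mem_image_of_mem f hx))
    rintro _ ⟨y, hy, rfl⟩
    exact hy
  · rintro h A _ ⟨x, hx, rfl⟩
    rw [mem_cl_iff] at hx ⊢
    exact (h x).frequently (hx.mono fun y hy => mem_image_of_mem f hy)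

lemma IsCont.comp {X : Type u} {Y : Type v} {Z : Type w} [ClosureSpace X] [ClosureSpace Y]
    [ClosureSpace Z] {g : Y → Z} {f : X → Y} (hg : IsCont g) (hf : IsCont f) :
    IsCont (g ∘ f) := by
  rw [isCont_iff_tendsto] at *
  exact fun x => (hg (f x)).comp (hf x)

lemma isCont_id {X : Type u} [ClosureSpace X] : IsCont (fun x : X => x) := by
  rw [isCont_iff_tendsto]
  exact fun x => Filter.tendsto_id

lemma isCont_const {X : Type u} {Y : Type v} [ClosureSpace X] [ClosureSpace Y] (y : Y) :
    IsCont (fun _ : X => y) := by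
  rintro A _ ⟨x, hx, rfl⟩
  apply subset_cl
  rcases A.eq_empty_or_nonempty with rfl | ⟨a, ha⟩
  · rw [cl_empty] at hx
    exact hx.elim
  · exact ⟨a, ha, rfl⟩

lemma nhd_pi {α : Type u} {X : α → Type v} [∀ a, ClosureSpace (X a)] (x : ∀ a, X a) :
    nhd x = Filter.pi (fun a => nhd (x a)) := by
  ext V
  change ¬ (∃ᶠ y in Filter.pi (fun a => nhd (x a)), y ∈ Vᶜ) ↔ _
  rw [Filter.not_frequently]
  simp only [mem_compl_iff, not_not]
  rfl

lemma isCont_pi {Z : Type w} [ClosureSpace Z] {α : Type u} {X : α → Type v}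
    [∀ a, ClosureSpace (X a)] {f : Z → ∀ a, X a} (h : ∀ a, IsCont (fun z => f z a)) :
    IsCont f := by
  rw [isCont_iff_tendsto]
  intro z
  rw [nhd_pi, Filter.tendsto_pi]
  intro a
  exact isCont_iff_tendsto.1 (h a) z

lemma isCont_apply {α : Type u} {X : α → Type v} [∀ a, ClosureSpace (X a)] (a : α) :
    IsCont (fun x : ∀ a, X a => x a) := by
  rw [isCont_iff_tendsto]
  intro x
  rw [nhd_pi]
  exact Filter.tendsto_eval_pi _ a

lemma isCont_ofTopology {X : Type u} {Y : Type v} [TopologicalSpace X] [TopologicalSpace Y]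
    {f : X → Y} (hf : Continuous f) :
    @IsCont X Y (ofTopology X) (ofTopology Y) f :=
  fun _ => image_closure_subset_closure_image hf

lemma isCont_ofRel {X : Type u} {Y : Type v} {r : X → X → Prop} {hr : ∀ x, r x x}
    {s : Y → Y → Prop} {hs : ∀ y, s y y} {f : X → Y} (hf : ∀ x x', r x x' → s (f x) (f x')) :
    @IsCont X Y (ofRel r hr) (ofRel s hs) f := by
  rintro A _ ⟨x, ⟨i, hi, h⟩, rfl⟩
  exact ⟨f i, mem_image_of_mem f hi, hf _ _ h⟩

end ClosureSpace

open ClosureSpace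

/-- The set of continuous maps between two closure spaces. -/
@[ext]
structure ContMap (X : Type u) (Y : Type v) [ClosureSpace X] [ClosureSpace Y] where
  /-- the underlying map -/
  toFun : X → Y
  cont : IsCont toFun

/-- Composition of continuous maps. -/
def ContMap.comp {X : Type u} {Y : Type v} {Z : Type w} [ClosureSpace X] [ClosureSpace Y]
    [ClosureSpace Z] (g : ContMap Y Z) (f : ContMap X Y) : ContMap X Z :=
  ⟨g.toFun ∘ f.toFun, g.cont.comp f.cont⟩

/-! ### The three intervals, their simplices and their cubes -/

/-- Names for the three intervals `I`, `J_+`, `J_1`. -/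
inductive Interval
  | I
  | Jplus
  | Jone

namespace Interval

/-- The underlying set of the interval. -/
def Pt : Interval → Type
  | I => unitInterval
  | Jplus => Fin 2
  | Jone => Fin 2

/-- `I` has its usual topology; on `J_+` we have `c(0) = {0, 1}` and `c(1) = {1}`; on `J_1` we have
`c(0) = c(1) = {0, 1}`. -/
instance instClosureSpacePt : ∀ J : Interval, ClosureSpace J.Pt
  | I => ofTopology unitInterval
  | Jplus => ofRel (X := Fin 2) (fun i j => i ≤ j) (fun i => le_refl i)
  | Jone => ofRel (X := Fin 2) (fun _ _ => True) (fun _ => trivial)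

/-- The endpoint `0`. -/
def zero : ∀ J : Interval, J.Pt
  | I => (0 : unitInterval)
  | Jplus => (0 : Fin 2)
  | Jone => (0 : Fin 2)

/-- The endpoint `1`. -/
def one : ∀ J : Interval, J.Pt
  | I => (1 : unitInterval)
  | Jplus => (1 : Fin 2)
  | Jone => (1 : Fin 2)

/-- The underlying set of the `n`-simplex: the standard simplex in `ℝ^(n+1)` for `J = I`, and
`{0, …, n}` for `J = J_+` and `J = J_1`. -/
def Simp : Interval → ℕ → Type
  | I, n => stdSimplex ℝ (Fin (n + 1))
  | Jplus, n => Fin (n + 1)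
  | Jone, n => Fin (n + 1)

/-- The closure on the `n`-simplex: the Euclidean topology for `J = I`, the closure
`c(i) = {j | i ≤ j}` for `J = J_+`, and the indiscrete closure for `J = J_1`. -/
instance instClosureSpaceSimp : ∀ (J : Interval) (n : ℕ), ClosureSpace (J.Simp n)
  | I, n => ofTopology (stdSimplex ℝ (Fin (n + 1)))
  | Jplus, n => ofRel (X := Fin (n + 1)) (fun i j => i ≤ j) (fun i => le_refl i)
  | Jone, n => ofRel (X := Fin (n + 1)) (fun _ _ => True) (fun _ => trivial)

/-- The map of simplices induced by a monotone map of vertices. -/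
noncomputable def simpMapFun : ∀ (J : Interval) {m n : ℕ},
    (Fin (m + 1) →o Fin (n + 1)) → J.Simp m → J.Simp n
  | I, _, _, f => stdSimplex.map (S := ℝ) f
  | Jplus, _, _, f => f
  | Jone, _, _, f => f

lemma isCont_simpMapFun (J : Interval) {m n : ℕ} (f : Fin (m + 1) →o Fin (n + 1)) :
    IsCont (J.simpMapFun f) := by
  cases J
  · exact isCont_ofTopology (X := stdSimplex ℝ (Fin (m + 1))) (Y := stdSimplex ℝ (Fin (n + 1)))
      (stdSimplex.continuous_map (S := ℝ) f)
  · exact isCont_ofRel (X := Fin (m + 1)) (Y := Fin (n + 1)) (r := fun i j => i ≤ j)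
      (hr := fun i => le_refl i) (s := fun i j => i ≤ j) (hs := fun i => le_refl i)
      (fun _ _ h => f.monotone h)
  · exact isCont_ofRel (X := Fin (m + 1)) (Y := Fin (n + 1)) (r := fun _ _ => True)
      (hr := fun _ => trivial) (s := fun _ _ => True) (hs := fun _ => trivial)
      (fun _ _ _ => trivial)

/-- `simpMapFun` as a continuous map. -/
noncomputable def simpMap (J : Interval) {m n : ℕ} (f : Fin (m + 1) →o Fin (n + 1)) :
    ContMap (J.Simp m) (J.Simp n) :=
  ⟨J.simpMapFun f, J.isCont_simpMapFun f⟩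

lemma simpMap_id (J : Interval) {n : ℕ} (x : J.Simp n) :
    (J.simpMap (OrderHom.id : Fin (n + 1) →o Fin (n + 1))).toFun x = x := by
  cases J
  · exact stdSimplex.map_id_apply x
  · rfl
  · rfl

lemma simpMap_comp (J : Interval) {l m n : ℕ} (g : Fin (m + 1) →o Fin (n + 1))
    (f : Fin (l + 1) →o Fin (m + 1)) (x : J.Simp l) :
    (J.simpMap (g.comp f)).toFun x = (J.simpMap g).toFun ((J.simpMap f).toFun x) := by
  cases J
  · exact (stdSimplex.map_comp_apply (S := ℝ) f g x).symm
  · rfl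
  · rfl

/-- The `n`-cube `J^{× n}`, with the product closure. -/
abbrev Cube (J : Interval) (n : ℕ) : Type := Fin n → J.Pt

/-- The coface `(a_1, …, a_n) ↦ (a_1, …, ε, …, a_n)` inserting `ε` at position `i`. -/
def cubeFace (J : Interval) {n : ℕ} (i : Fin (n + 1)) (ε : J.Pt) :
    ContMap (J.Cube n) (J.Cube (n + 1)) where
  toFun a := i.insertNth (α := fun _ => J.Pt) ε a
  cont := by
    refine isCont_pi fun k => ?_
    refine Fin.succAboveCases i ?_ (fun k => ?_) k
    · simpa using isCont_const ε
    · simpa using isCont_apply k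

end Interval

/-! ### Subcomplexes and quotient complexes of chain complexes of abelian groups -/

/-- A subcomplex of a chain complex of abelian groups. -/
@[ext]
structure Subcomplex (K : ChainComplex AddCommGrpCat.{u} ℕ) where
  /-- the subgroup in each degree -/
  carrier : ∀ n, AddSubgroup (K.X n)
  d_mem : ∀ i j, ∀ x ∈ carrier i, (K.d i j).hom x ∈ carrier j

namespace Subcomplex

variable {K : ChainComplex AddCommGrpCat.{u} ℕ}

/-- The full complex as a subcomplex of itself. -/
def full (K : ChainComplex AddCommGrpCat.{u} ℕ) : Subcomplex K where
  carrier _ := ⊤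
  d_mem _ _ _ _ := AddSubgroup.mem_top _

lemma d_d_apply (K : ChainComplex AddCommGrpCat.{u} ℕ) (i j k : ℕ) (x : K.X i) :
    (K.d j k).hom ((K.d i j).hom x) = 0 := by
  rw [← AddMonoidHom.comp_apply, ← AddCommGrpCat.hom_comp, K.d_comp_d]
  rfl

lemma d_shape_apply (K : ChainComplex AddCommGrpCat.{u} ℕ) {i j : ℕ}
    (h : ¬ (ComplexShape.down ℕ).Rel i j) (x : K.X i) : (K.d i j).hom x = 0 := by
  rw [K.shape i j h]
  rfl

/-- A subcomplex as a chain complex. -/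
noncomputable def toComplex (N : Subcomplex K) : ChainComplex AddCommGrpCat.{u} ℕ where
  X n := AddCommGrpCat.of (N.carrier n)
  d i j := AddCommGrpCat.ofHom
    (((K.d i j).hom.comp (N.carrier i).subtype).codRestrict (N.carrier j)
      (fun x => N.d_mem i j x.1 x.2))
  shape _ _ h := AddCommGrpCat.hom_ext (AddMonoidHom.ext fun x =>
    Subtype.ext (d_shape_apply K h x.1))
  d_comp_d' i j k _ _ := AddCommGrpCat.hom_ext (AddMonoidHom.ext fun x =>
    Subtype.ext (d_d_apply K i j k x.1))

/-- The inclusion of a subcomplex. -/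
noncomputable def incl (N : Subcomplex K) : N.toComplex ⟶ K where
  f n := AddCommGrpCat.ofHom (N.carrier n).subtype
  comm' _ _ _ := AddCommGrpCat.hom_ext (AddMonoidHom.ext fun _ => rfl)

/-- The quotient complex `K / N`. -/
noncomputable def quotient (N : Subcomplex K) : ChainComplex AddCommGrpCat.{u} ℕ where
  X n := AddCommGrpCat.of (K.X n ⧸ N.carrier n)
  d i j := AddCommGrpCat.ofHom
    (QuotientAddGroup.map (N.carrier i) (N.carrier j) (K.d i j).hom (N.d_mem i j))
  shape i j h := by
    refine AddCommGrpCat.hom_ext (QuotientAddGroup.addMonoidHom_ext _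
      (AddMonoidHom.ext fun x => ?_))
    change QuotientAddGroup.mk ((K.d i j).hom x) = 0
    rw [d_shape_apply K h]
    rfl
  d_comp_d' i j k _ _ := by
    refine AddCommGrpCat.hom_ext (QuotientAddGroup.addMonoidHom_ext _
      (AddMonoidHom.ext fun x => ?_))
    change QuotientAddGroup.mk ((K.d j k).hom ((K.d i j).hom x)) = 0
    rw [d_d_apply K]
    rfl

/-- The image of a subcomplex `M` of `K` in the quotient complex `K / N`. -/
noncomputable def mapQuotient (M N : Subcomplex K) : Subcomplex N.quotient where
  carrier n := (M.carrier n).map (QuotientAddGroup.mk' (N.carrier n))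
  d_mem := by
    rintro i j _ ⟨x, hx, rfl⟩
    exact AddSubgroup.mem_map_of_mem (QuotientAddGroup.mk' (N.carrier j)) (M.d_mem i j x hx)

/-- Subgroups that are generated by sets and preserved by the differentials
`K_(n+1) → K_n` on these generators form a subcomplex. -/
noncomputable def generate (G : ∀ n, Set (K.X n))
    (hG : ∀ n, ∀ x ∈ G (n + 1), (K.d (n + 1) n).hom x ∈ AddSubgroup.closure (G n)) :
    Subcomplex K where
  carrier n := AddSubgroup.closure (G n)
  d_mem i j x hx := by
    by_cases h : (ComplexShape.down ℕ).Rel i j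
    · obtain rfl : j + 1 = i := h
      have : AddSubgroup.closure (G (j + 1)) ≤
          (AddSubgroup.closure (G j)).comap (K.d (j + 1) j).hom :=
        (AddSubgroup.closure_le _).2 (hG j)
      exact this hx
    · rw [d_shape_apply K h]
      exact zero_mem _

end Subcomplex

/-- The functor sending a set `S` to the free abelian group on `S`. -/
noncomputable def freeAb : Type u ⥤ AddCommGrpCat.{u} where
  obj S := AddCommGrpCat.of (S →₀ ℤ)
  map f := AddCommGrpCat.ofHom (Finsupp.mapDomain.addMonoidHom f)
  map_id _ := AddCommGrpCat.hom_ext (AddMonoidHom.ext fun _ => Finsupp.mapDomain_id)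
  map_comp f g := AddCommGrpCat.hom_ext (AddMonoidHom.ext fun _ =>
    Finsupp.mapDomain_comp (M := ℤ) (f := f) (g := g))

/-- A map into `X` is `U`-small if its image lies in a single member of `U`. -/
def IsSmall {X : Type u} {ι : Type v} (U : ι → Set X) {Z : Type w} (f : Z → X) : Prop :=
  ∃ j, range f ⊆ U j

lemma IsSmall.comp {X : Type u} {ι : Type v} {U : ι → Set X} {Z : Type w} {W : Type*} {f : Z → X}
    (hf : IsSmall U f) (g : W → Z) : IsSmall U (f ∘ g) := by
  obtain ⟨j, hj⟩ := hf
  exact ⟨j, (range_comp_subset_range g f).trans hj⟩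

/-! ### Singular simplicial chains -/

/-- The `J` nerve of `X`: its `n`-simplices are the continuous maps from the `n`-simplex to `X`. -/
noncomputable def nerve (J : Interval) (X : Type u) [ClosureSpace X] : SSet.{u} where
  obj n := ContMap (J.Simp n.unop.len) X
  map f := ↾fun σ => σ.comp (J.simpMap f.unop.toOrderHom)
  map_id n := by
    refine ConcreteCategory.hom_ext _ _ fun σ => ?_
    apply ContMap.ext
    funext x
    exact congrArg σ.toFun (J.simpMap_id x)
  map_comp f g := by
    refine ConcreteCategory.hom_ext _ _ fun σ => ?_
    apply ContMap.ext
    funext x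
    exact congrArg σ.toFun (J.simpMap_comp f.unop.toOrderHom g.unop.toOrderHom x)

/-- The singular simplicial chain complex of `X`: the complex of free abelian groups on the
simplices of the `J` nerve, with `∂ = ∑ (-1)^i d_i`. -/
noncomputable def simplicialChains (J : Interval) (X : Type u) [ClosureSpace X] :
    ChainComplex AddCommGrpCat.{u} ℕ :=
  AlgebraicTopology.AlternatingFaceMapComplex.obj
    (((SimplicialObject.whiskering (Type u) AddCommGrpCat.{u}).obj freeAb).obj (nerve J X))

/-- A singular simplex as an element of the group of singular chains. -/
noncomputable def simplexChain {J : Interval} {X : Type u} [ClosureSpace X] {n : ℕ}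
    (σ : ContMap (J.Simp n) X) : (simplicialChains J X).X n :=
  (Finsupp.single σ 1 : ContMap (J.Simp n) X →₀ ℤ)

/-- The `i`-th face of a singular simplex. -/
noncomputable def simplexFace {J : Interval} {X : Type u} [ClosureSpace X] {n : ℕ}
    (i : Fin (n + 2)) (σ : ContMap (J.Simp (n + 1)) X) : ContMap (J.Simp n) X :=
  σ.comp (J.simpMap (Fin.succAboveOrderEmb i).toOrderHom)

lemma simplicialChains_d {J : Interval} {X : Type u} [ClosureSpace X] {n : ℕ}
    (σ : ContMap (J.Simp (n + 1)) X) :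
    ((simplicialChains J X).d (n + 1) n).hom (simplexChain σ) =
      ∑ i : Fin (n + 2), (-1 : ℤ) ^ (i : ℕ) • simplexChain (simplexFace i σ) := by
  have h := AlgebraicTopology.AlternatingFaceMapComplex.obj_d_eq
    (((SimplicialObject.whiskering (Type u) AddCommGrpCat.{u}).obj freeAb).obj (nerve J X)) n
  refine (congrArg (fun f => AddCommGrpCat.Hom.hom f (simplexChain σ)) h).trans ?_
  let ev : ((simplicialChains J X).X (n + 1) ⟶ (simplicialChains J X).X n) →+
      (simplicialChains J X).X n :=
    { toFun := fun f => f.hom (simplexChain σ), map_zero' := rfl, map_add' := fun _ _ => rfl }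
  refine (map_sum ev _ _).trans (Finset.sum_congr rfl fun i _ => (map_zsmul ev _ _).trans ?_)
  congr 1
  exact Finsupp.mapDomain_single

/-- The subcomplex of the singular simplicial chains generated by the `U`-small simplices. -/
noncomputable def smallSimplicialChains (J : Interval) {X : Type u} [ClosureSpace X] {ι : Type v}
    (U : ι → Set X) : Subcomplex (simplicialChains J X) :=
  Subcomplex.generate
    (fun n => {c | ∃ σ : ContMap (J.Simp n) X, IsSmall U σ.toFun ∧ c = simplexChain σ})
    (by
      rintro n _ ⟨σ, hσ, rfl⟩
      rw [simplicialChains_d]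
      refine sum_mem fun i _ => zsmul_mem (AddSubgroup.subset_closure ?_) _
      exact ⟨simplexFace i σ, hσ.comp _, rfl⟩)

/-! ### Singular cubical chains for the product `×` -/

section Cubical

variable {J : Interval} {X : Type u} [ClosureSpace X]

/-- The faces of a singular cube: `A_i σ` for `ε = 0` and `B_i σ` for `ε = 1`. -/
def cubeFaceMap {n : ℕ} (i : Fin (n + 1)) (ε : J.Pt) (σ : ContMap (J.Cube (n + 1)) X) :
    ContMap (J.Cube n) X :=
  σ.comp (J.cubeFace i ε)

/-- The operator `A_i - B_i`, where `i` runs through `0, …, n`. -/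
noncomputable def cubeDiff (J : Interval) (X : Type u) [ClosureSpace X] (n : ℕ) (i : Fin (n + 1)) :
    (ContMap (J.Cube (n + 1)) X →₀ ℤ) →+ (ContMap (J.Cube n) X →₀ ℤ) :=
  Finsupp.mapDomain.addMonoidHom (cubeFaceMap i J.zero) -
    Finsupp.mapDomain.addMonoidHom (cubeFaceMap i J.one)

/-- The boundary `∑_{i=1}^{n+1} (-1)^i (A_i - B_i)`. -/
noncomputable def cubeBoundary (J : Interval) (X : Type u) [ClosureSpace X] (n : ℕ) :
    (ContMap (J.Cube (n + 1)) X →₀ ℤ) →+ (ContMap (J.Cube n) X →₀ ℤ) :=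
  ∑ i : Fin (n + 1), (-1 : ℤ) ^ ((i : ℕ) + 1) • cubeDiff J X n i

lemma cubeDiff_single {n : ℕ} (i : Fin (n + 1)) (σ : ContMap (J.Cube (n + 1)) X) :
    cubeDiff J X n i (Finsupp.single σ 1) =
      Finsupp.single (cubeFaceMap i J.zero σ) 1 - Finsupp.single (cubeFaceMap i J.one σ) 1 := by
  simp [cubeDiff, Finsupp.mapDomain.addMonoidHom]

lemma cubeBoundary_single {n : ℕ} (σ : ContMap (J.Cube (n + 1)) X) :
    cubeBoundary J X n (Finsupp.single σ 1) =
      ∑ i : Fin (n + 1), (-1 : ℤ) ^ ((i : ℕ) + 1) •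
        ((Finsupp.single (cubeFaceMap i J.zero σ) 1 : ContMap (J.Cube n) X →₀ ℤ) -
          Finsupp.single (cubeFaceMap i J.one σ) 1) := by
  simp only [cubeBoundary, AddMonoidHom.finsetSum_apply, AddMonoidHom.smul_apply,
    cubeDiff_single]

lemma cubeFaceMap_comm {n : ℕ} {i j : Fin (n + 1)} (h : i ≤ j) (ε δ : J.Pt)
    (σ : ContMap (J.Cube (n + 2)) X) :
    cubeFaceMap i ε (cubeFaceMap j.succ δ σ) =
      cubeFaceMap j δ (cubeFaceMap i.castSucc ε σ) := by
  apply ContMap.ext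
  funext a
  change σ.toFun _ = σ.toFun _
  congr 1
  change j.succ.insertNth (α := fun _ => J.Pt) δ (i.insertNth (α := fun _ => J.Pt) ε a) =
    i.castSucc.insertNth (α := fun _ => J.Pt) ε (j.insertNth (α := fun _ => J.Pt) δ a)
  have h1 : j.succ = i.castSucc.succAbove j :=
    (Fin.succAbove_of_le_castSucc _ _ (Fin.castSucc_le_castSucc_iff.2 h)).symm
  have h2 : j.succ.succAbove i = i.castSucc :=
    Fin.succAbove_of_castSucc_lt _ _ (Fin.castSucc_lt_succ_iff.2 h)
  have h3 : ∀ k : Fin n, j.succ.succAbove (i.succAbove k) =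
      i.castSucc.succAbove (j.succAbove k) := by
    intro k
    have hij : (i : ℕ) ≤ j := h
    have hv : ∀ {m : ℕ} (p : Fin (m + 1)) (q : Fin m),
        (p.succAbove q : ℕ) = if (q : ℕ) < p then (q : ℕ) else q + 1 := by
      intro m p q
      rw [Fin.succAbove, apply_ite Fin.val]
      rfl
    rw [Fin.ext_iff, hv, hv, hv, hv, Fin.val_succ, Fin.val_castSucc]
    split_ifs <;> omega
  funext k
  refine Fin.succAboveCases j.succ ?_ (fun k => Fin.succAboveCases i ?_ (fun k => ?_) k) k
  · rw [Fin.insertNth_apply_same, h1, Fin.insertNth_apply_succAbove, Fin.insertNth_apply_same]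
  · rw [Fin.insertNth_apply_succAbove, Fin.insertNth_apply_same, h2, Fin.insertNth_apply_same]
  · rw [Fin.insertNth_apply_succAbove, Fin.insertNth_apply_succAbove, h3,
      Fin.insertNth_apply_succAbove, Fin.insertNth_apply_succAbove]

lemma cubeDiff_comm {n : ℕ} {i j : Fin (n + 1)} (h : i ≤ j)
    (x : ContMap (J.Cube (n + 2)) X →₀ ℤ) :
    cubeDiff J X n i (cubeDiff J X (n + 1) j.succ x) =
      cubeDiff J X n j (cubeDiff J X (n + 1) i.castSucc x) := by
  have : (cubeDiff J X n i).comp (cubeDiff J X (n + 1) j.succ) =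
      (cubeDiff J X n j).comp (cubeDiff J X (n + 1) i.castSucc) := by
    refine Finsupp.addHom_ext' fun σ => AddMonoidHom.ext_int ?_
    change cubeDiff J X n i (cubeDiff J X (n + 1) j.succ (Finsupp.single σ 1)) =
      cubeDiff J X n j (cubeDiff J X (n + 1) i.castSucc (Finsupp.single σ 1))
    simp only [cubeDiff_single, map_sub, cubeFaceMap_comm h]
    abel
  exact DFunLike.congr_fun this x

lemma sum_alternating_eq_zero {A : Type u} [AddCommGroup A] {n : ℕ}
    (F : Fin (n + 1) → Fin (n + 2) → A)
    (hF : ∀ i j : Fin (n + 1), i ≤ j → F i j.succ = F j i.castSucc) :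
    ∑ i : Fin (n + 1), ∑ j : Fin (n + 2), (-1 : ℤ) ^ ((i : ℕ) + (j : ℕ)) • F i j = 0 := by
  rw [← Finset.sum_product']
  let P := Fin (n + 1) × Fin (n + 2)
  let S : Finset P := {ij : P | (ij.2 : ℕ) ≤ (ij.1 : ℕ)}
  rw [Finset.univ_product_univ, ← Finset.sum_add_sum_compl S, ← eq_neg_iff_add_eq_zero,
    ← Finset.sum_neg_distrib]
  let φ : ∀ ij : P, ij ∈ S → P := fun ij hij =>
    (Fin.castLT ij.2 (lt_of_le_of_lt (Finset.mem_filter.mp hij).right (Fin.is_lt ij.1)), ij.1.succ)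
  apply Finset.sum_bij φ
  · intro ij hij
    simp_rw [S, φ, Finset.compl_filter, Finset.mem_filter_univ, Fin.val_succ,
      Fin.val_castLT] at hij ⊢
    omega
  · rintro ⟨i, j⟩ hij ⟨i', j'⟩ hij' h
    have h1 : (j : ℕ) = j' := congrArg (fun p => (p.1 : ℕ)) h
    have h2 : (i : ℕ) + 1 = i' + 1 := congrArg (fun p => (p.2 : ℕ)) h
    rw [Prod.mk_inj, Fin.ext_iff, Fin.ext_iff]
    omega
  · rintro ⟨i', j'⟩ hij'
    simp_rw [S, Finset.compl_filter, Finset.mem_filter_univ, not_le] at hij'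
    refine ⟨(j'.pred ?_, Fin.castSucc i'), ?_, ?_⟩
    · rintro rfl
      simp only [Fin.val_zero, not_lt_zero] at hij'
    · simp only [S, Finset.mem_filter_univ, Fin.val_castSucc, Fin.val_pred]
      omega
    · simp only [φ, Fin.castLT_castSucc, Fin.succ_pred]
  · rintro ⟨i, j⟩ hij
    have hij' : (j : ℕ) ≤ i := by simpa [S] using hij
    have hj : (j : ℕ) < n + 1 := lt_of_le_of_lt hij' i.2
    change (-1 : ℤ) ^ ((i : ℕ) + j) • F i j =
      -((-1 : ℤ) ^ ((j : ℕ) + (i + 1)) • F (j.castLT hj) i.succ)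
    rw [hF (j.castLT hj) i hij', Fin.castSucc_castLT, ← neg_smul, ← add_assoc, pow_succ, mul_neg,
      mul_one, neg_neg, add_comm (j : ℕ)]

lemma cubeBoundary_cubeBoundary (J : Interval) (X : Type u) [ClosureSpace X] (n : ℕ)
    (x : ContMap (J.Cube (n + 2)) X →₀ ℤ) :
    cubeBoundary J X n (cubeBoundary J X (n + 1) x) = 0 := by
  rw [← sum_alternating_eq_zero (fun i j => cubeDiff J X n i (cubeDiff J X (n + 1) j x))
    (fun i j h => cubeDiff_comm h x)]
  simp only [cubeBoundary, AddMonoidHom.finsetSum_apply, AddMonoidHom.smul_apply, map_sum, map_zsmul,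
    Finset.smul_sum, smul_smul]
  rw [Finset.sum_comm]
  refine Fintype.sum_congr _ _ fun i => Fintype.sum_congr _ _ fun j => ?_
  congr 1
  ring

/-- The unnormalized singular cubical chain complex of `X`, for the product `×`. -/
noncomputable def unnormalizedCubicalChains (J : Interval) (X : Type u) [ClosureSpace X] :
    ChainComplex AddCommGrpCat.{u} ℕ :=
  ChainComplex.of (fun n => AddCommGrpCat.of (ContMap (J.Cube n) X →₀ ℤ))
    (fun n => AddCommGrpCat.ofHom (cubeBoundary J X n))
    (fun n => AddCommGrpCat.hom_ext (AddMonoidHom.ext (cubeBoundary_cubeBoundary J X n)))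

/-- A singular cube as an element of the group of unnormalized cubical chains. -/
noncomputable def cubeChain {n : ℕ} (σ : ContMap (J.Cube n) X) :
    (unnormalizedCubicalChains J X).X n :=
  (Finsupp.single σ 1 : ContMap (J.Cube n) X →₀ ℤ)

lemma unnormalizedCubicalChains_d {n : ℕ} (σ : ContMap (J.Cube (n + 1)) X) :
    ((unnormalizedCubicalChains J X).d (n + 1) n).hom (cubeChain σ) =
      ∑ i : Fin (n + 1), (-1 : ℤ) ^ ((i : ℕ) + 1) •
        (cubeChain (cubeFaceMap i J.zero σ) - cubeChain (cubeFaceMap i J.one σ)) := by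
  have h := ChainComplex.of_d (fun n => AddCommGrpCat.of (ContMap (J.Cube n) X →₀ ℤ))
    (fun n => AddCommGrpCat.ofHom (cubeBoundary J X n)) n
  refine (congrArg (fun f => AddCommGrpCat.Hom.hom f (cubeChain σ)) h).trans ?_
  exact cubeBoundary_single σ

/-- A singular cube is degenerate if it does not depend on one of the coordinates, that is, if it
factors through the projection which omits that coordinate. -/
def IsDegenerate {n : ℕ} (σ : ContMap (J.Cube n) X) : Prop :=
  ∃ i : Fin n, ∀ a b : J.Cube n, (∀ k, k ≠ i → a k = b k) → σ.toFun a = σ.toFun b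

/-- The degenerate cubes are the cubes in the image of one of the degeneracy operators
`s_i τ (a_1, …, a_(n+1)) = τ (a_1, …, a_(i-1), a_(i+1), …, a_(n+1))`. -/
lemma isDegenerate_iff {n : ℕ} (σ : ContMap (J.Cube (n + 1)) X) :
    IsDegenerate σ ↔ ∃ (i : Fin (n + 1)) (τ : ContMap (J.Cube n) X),
      ∀ a, σ.toFun a = τ.toFun (fun k => a (i.succAbove k)) := by
  constructor
  · rintro ⟨i, hi⟩
    refine ⟨i, cubeFaceMap i J.zero σ, fun a => hi _ _ fun k hk => ?_⟩
    obtain ⟨k, rfl⟩ := Fin.exists_succAbove_eq hk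
    exact (Fin.insertNth_apply_succAbove (α := fun _ => J.Pt) i J.zero
      (fun k => a (i.succAbove k)) k).symm
  · rintro ⟨i, τ, h⟩
    refine ⟨i, fun a b hab => ?_⟩
    rw [h, h]
    congr 1
    funext k
    exact hab _ (Fin.succAbove_ne i k)

lemma IsDegenerate.face {n : ℕ} {σ : ContMap (J.Cube (n + 1)) X} {i : Fin (n + 1)}
    (hi : ∀ a b : J.Cube (n + 1), (∀ k, k ≠ i → a k = b k) → σ.toFun a = σ.toFun b)
    {k : Fin (n + 1)} (hk : k ≠ i) (ε : J.Pt) : IsDegenerate (cubeFaceMap k ε σ) := by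
  obtain ⟨i, rfl⟩ := Fin.exists_succAbove_eq hk.symm
  refine ⟨i, fun a b hab => hi _ _ fun l hl => ?_⟩
  change k.insertNth (α := fun _ => J.Pt) ε a l = k.insertNth (α := fun _ => J.Pt) ε b l
  revert hl
  refine Fin.succAboveCases k ?_ (fun l => ?_) l
  · intro _
    rw [Fin.insertNth_apply_same, Fin.insertNth_apply_same]
  · intro hl
    rw [Fin.insertNth_apply_succAbove, Fin.insertNth_apply_succAbove]
    exact hab l fun h => hl (by rw [h])

/-- The subcomplex generated by the degenerate cubes. -/
noncomputable def degenerateChains (J : Interval) (X : Type u) [ClosureSpace X] :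
    Subcomplex (unnormalizedCubicalChains J X) :=
  Subcomplex.generate
    (fun n => {c | ∃ σ : ContMap (J.Cube n) X, IsDegenerate σ ∧ c = cubeChain σ})
    (by
      rintro n _ ⟨σ, ⟨i, hi⟩, rfl⟩
      rw [unnormalizedCubicalChains_d]
      refine sum_mem fun k _ => zsmul_mem ?_ _
      by_cases hk : k = i
      · subst hk
        have : cubeFaceMap k J.zero σ = cubeFaceMap k J.one σ := by
          apply ContMap.ext
          funext a
          refine hi _ _ fun l hl => ?_
          obtain ⟨l, rfl⟩ := Fin.exists_succAbove_eq hl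
          change k.insertNth (α := fun _ => J.Pt) _ a _ = k.insertNth (α := fun _ => J.Pt) _ a _
          rw [Fin.insertNth_apply_succAbove, Fin.insertNth_apply_succAbove]
        rw [this, sub_self]
        exact zero_mem _
      · refine sub_mem (AddSubgroup.subset_closure ?_) (AddSubgroup.subset_closure ?_)
        · exact ⟨_, IsDegenerate.face hi hk _, rfl⟩
        · exact ⟨_, IsDegenerate.face hi hk _, rfl⟩)

/-- The `(J, ×)` singular cubical chain complex of `X`: unnormalized chains modulo degenerate
chains. -/
noncomputable def cubicalChains (J : Interval) (X : Type u) [ClosureSpace X] :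
    ChainComplex AddCommGrpCat.{u} ℕ :=
  (degenerateChains J X).quotient

/-- The subcomplex of the unnormalized cubical chains generated by the `U`-small cubes. -/
noncomputable def smallUnnormalizedCubicalChains (J : Interval) {X : Type u} [ClosureSpace X]
    {ι : Type v} (U : ι → Set X) : Subcomplex (unnormalizedCubicalChains J X) :=
  Subcomplex.generate
    (fun n => {c | ∃ σ : ContMap (J.Cube n) X, IsSmall U σ.toFun ∧ c = cubeChain σ})
    (by
      rintro n _ ⟨σ, hσ, rfl⟩
      rw [unnormalizedCubicalChains_d]
      refine sum_mem fun k _ => zsmul_mem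
        (sub_mem (AddSubgroup.subset_closure ?_) (AddSubgroup.subset_closure ?_)) _
      · exact ⟨_, hσ.comp _, rfl⟩
      · exact ⟨_, hσ.comp _, rfl⟩)

/-- The subcomplex of the `(J, ×)` singular cubical chains generated by the (classes of the)
`U`-small cubes. -/
noncomputable def smallCubicalChains (J : Interval) {X : Type u} [ClosureSpace X]
    {ι : Type v} (U : ι → Set X) : Subcomplex (cubicalChains J X) :=
  (smallUnnormalizedCubicalChains J U).mapQuotient (degenerateChains J X)

end Cubical

end CechClosure

namespace CechClosure

open CategoryTheory Set ClosureSpace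

/-! ### Free generators -/

/-! For `J = I` this is the theorem of small chains. The data needed are collected in `Subdivision`:
an operator `S` and a homotopy `T` with `dT + Td ≡ 1 - S` modulo the subcomplex `N`, such that every
chain is moved into `N` by some power of `S`. The power exists by a Lebesgue number argument. `X`
need not be topological, but continuity of `σ` makes the interiors of the preimages of the `U j` an
open cover of a compact metric simplex or cube, and subdivision shrinks the pieces geometrically
(`exists_isFine`, `IsFine.subcube`, `iterate_sd_mem_fineChains`).

The number of subdivisions depends on the chain, and no explicit formula for the homotopy is written
down. Instead, telescoping `T` shows that every cycle modulo `N` is a boundary modulo `N`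
(`exists_fill`). Since `K` is free and `N` is spanned by part of a basis, a contraction `D` of `K`
modulo `N` that vanishes on `N` can be chosen degree by degree (`nonempty_deformation`). Then `1 -
dD - Dd` maps `K` onto `N`, is the identity on `N`, and is homotopic to the identity of `K`, so the
inclusion is a homotopy equivalence (`Deformation.homotopyEquiv`).

For simplices, `S` is barycentric subdivision, computed on formal tuples of points of the standard
simplex. For cubes, `S` cuts every edge in half and `T` is a sliding homotopy which is correct only
up to degenerate cubes. The deformation is therefore built on unnormalized chains, with `N` spanned
by the small and the degenerate cubes, and then passes to the quotient.

For `J_+` and `J_1`, every simplex and every cube has a point whose only neighborhood is the whole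
space. A continuous map sends all of it into any `U j` that is a neighborhood of the image of that
point, so every generator is small. -/

/-- The family `e` is a basis of the abelian group `A`. -/
def IsFreeBasis {B : Type*} {A : Type*} [AddCommGroup A] (e : B → A) : Prop :=
  ∃ φ : (B →₀ ℤ) ≃+ A, ∀ b, φ (Finsupp.single b 1) = e b

namespace IsFreeBasis

variable {B : Type*} {A : Type*} [AddCommGroup A] {e : B → A}

lemma exists_lift (h : IsFreeBasis e) {A' : Type*} [AddCommGroup A'] (f : B → A') :
    ∃ F : A →+ A', ∀ b, F (e b) = f b := by
  obtain ⟨φ, hφ⟩ := h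
  refine ⟨(Finsupp.liftAddHom fun b => zmultiplesHom A' (f b)).comp φ.symm.toAddMonoidHom,
    fun b => ?_⟩
  simp [← hφ]

lemma mem_of_forall (h : IsFreeBasis e) (H : AddSubgroup A) (hH : ∀ b, e b ∈ H) (x : A) :
    x ∈ H := by
  obtain ⟨φ, hφ⟩ := h
  obtain ⟨y, rfl⟩ := φ.surjective x
  induction y using Finsupp.induction_linear with
  | zero => simp
  | add f g hf hg => rw [map_add]; exact add_mem hf hg
  | single b k =>
    have : Finsupp.single b k = k • (Finsupp.single b 1 : B →₀ ℤ) := by simp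
    rw [this, map_zsmul, hφ]
    exact zsmul_mem (hH b) k

end IsFreeBasis

/-! ### Deformations of a chain complex into a subcomplex -/

section Deformation

variable {K : ChainComplex AddCommGrpCat.{u} ℕ}

/-- Operators which raise the degree by one, vanish on `N`, and contract `K` modulo `N`. -/
structure Deformation (N : Subcomplex K) where
  /-- the operators -/
  D : ∀ n, K.X n →+ K.X (n + 1)
  D_eq_zero : ∀ n, ∀ x ∈ N.carrier n, D n x = 0
  mem_zero : ∀ x : K.X 0, (K.d 1 0).hom (D 0 x) - x ∈ N.carrier 0
  mem_succ : ∀ n, ∀ x : K.X (n + 1),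
    (K.d (n + 2) (n + 1)).hom (D (n + 1) x) + D n ((K.d (n + 1) n).hom x) - x ∈ N.carrier (n + 1)

namespace Deformation

variable {N : Subcomplex K} (h : Deformation N)

/-- The components of the homotopy given by a deformation. -/
noncomputable def hom (i j : ℕ) (hij : (ComplexShape.down ℕ).Rel j i) : K.X i ⟶ K.X j :=
  -- `hij` says `i + 1 = j`; the transport replaces `K.X (i + 1)` by `K.X j`.
  AddCommGrpCat.ofHom (h.D i) ≫ eqToHom (congrArg K.X hij)

/-- The null homotopic map `dD + Dd`. -/
noncomputable def null : K ⟶ K := Homotopy.nullHomotopicMap' h.hom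

lemma null_zero (x : K.X 0) : (h.null.f 0).hom x = (K.d 1 0).hom (h.D 0 x) := by
  have := Homotopy.nullHomotopicMap'_f_of_not_rel_left (c := ComplexShape.down ℕ)
    (k₁ := 1) (k₀ := 0) rfl (fun l hl => by simp at hl) h.hom
  rw [null, this]
  simp [hom]

lemma null_succ (n : ℕ) (x : K.X (n + 1)) : (h.null.f (n + 1)).hom x =
    (K.d (n + 2) (n + 1)).hom (h.D (n + 1) x) + h.D n ((K.d (n + 1) n).hom x) := by
  have := Homotopy.nullHomotopicMap'_f (c := ComplexShape.down ℕ)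
    (k₂ := n + 2) (k₁ := n + 1) (k₀ := n) rfl rfl h.hom
  rw [null, this]
  simp [hom, add_comm]

/-- This makes `1 - dD - Dd` take values in `N`. Degree `0` is separate because the term `Dd` is
absent there. -/
lemma sub_null_mem (n : ℕ) (x : K.X n) : x - (h.null.f n).hom x ∈ N.carrier n := by
  rw [← neg_mem_iff, neg_sub]
  cases n with
  | zero => rw [null_zero]; exact h.mem_zero x
  | succ n => rw [null_succ]; exact h.mem_succ n x

/-- Since `N` is closed under `d`, both `D x` and `D (d x)` vanish. Hence the retraction restricts
to the identity on `N` strictly, not only up to homotopy. -/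
lemma null_eq_zero (n : ℕ) {x : K.X n} (hx : x ∈ N.carrier n) : (h.null.f n).hom x = 0 := by
  cases n with
  | zero => rw [null_zero, h.D_eq_zero _ _ hx, map_zero]
  | succ n =>
    rw [null_succ, h.D_eq_zero _ _ hx, h.D_eq_zero _ _ (N.d_mem _ _ _ hx), map_zero, add_zero]

/-- The retraction `1 - dD - Dd` onto the subcomplex. -/
noncomputable def retraction : K ⟶ N.toComplex where
  f n := AddCommGrpCat.ofHom
    (((𝟙 K - h.null : K ⟶ K).f n).hom.codRestrict (N.carrier n) (h.sub_null_mem n))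
  comm' i j _ := AddCommGrpCat.hom_ext (AddMonoidHom.ext fun x => Subtype.ext
    (congrArg (fun f => AddCommGrpCat.Hom.hom f x) ((𝟙 K - h.null : K ⟶ K).comm i j)))

lemma incl_retraction : N.incl ≫ h.retraction = 𝟙 _ := by
  ext n x
  refine Subtype.ext ?_
  change x.1 - (h.null.f n).hom x.1 = x.1
  rw [h.null_eq_zero n x.2, sub_zero]

lemma retraction_incl : h.retraction ≫ N.incl = 𝟙 K - h.null := by
  ext n x
  rfl

/-- The inclusion of a subcomplex with a deformation is a homotopy equivalence. -/
noncomputable def homotopyEquiv : HomotopyEquiv N.toComplex K where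
  hom := N.incl
  inv := h.retraction
  homotopyHomInvId := Homotopy.ofEq h.incl_retraction
  homotopyInvHomId := (Homotopy.ofEq (h.retraction_incl.trans (add_zero _).symm)).trans
    (((Homotopy.refl (𝟙 K - h.null)).add (Homotopy.nullHomotopy' h.hom).symm).trans
      (Homotopy.ofEq (sub_add_cancel _ _)))

/-- A subcomplex which is everything has the zero deformation. -/
def ofEqTop (hN : ∀ n, N.carrier n = ⊤) : Deformation N where
  D _ := 0
  D_eq_zero _ _ _ := rfl
  mem_zero _ := by rw [hN]; trivial
  mem_succ _ _ := by rw [hN]; trivial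

end Deformation

/-- Operators `S`, `T` such that, modulo a subcomplex, `T` is a homotopy from `S` to the identity
and `S` is locally nilpotent. -/
structure Subdivision (N : Subcomplex K) where
  /-- the subdivision -/
  S : ∀ n, K.X n →+ K.X n
  /-- the homotopy -/
  T : ∀ n, K.X n →+ K.X (n + 1)
  S_mem : ∀ n, ∀ x ∈ N.carrier n, S n x ∈ N.carrier n
  T_mem : ∀ n, ∀ x ∈ N.carrier n, T n x ∈ N.carrier (n + 1)
  mem_zero : ∀ x : K.X 0, (K.d 1 0).hom (T 0 x) - (x - S 0 x) ∈ N.carrier 0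
  mem_succ : ∀ n, ∀ x : K.X (n + 1),
    (K.d (n + 2) (n + 1)).hom (T (n + 1) x) + T n ((K.d (n + 1) n).hom x) - (x - S (n + 1) x) ∈
      N.carrier (n + 1)
  nilpotent : ∀ n, ∀ x : K.X n, ∃ m : ℕ, (S n)^[m] x ∈ N.carrier n

namespace Subdivision

variable {N : Subcomplex K} (s : Subdivision N)

/-- Cycles of `K` modulo `N`. -/
def IsRelCycle (N : Subcomplex K) {n : ℕ} (x : K.X n) : Prop :=
  ∀ j, (K.d n j).hom x ∈ N.carrier j

-- The term `T (d x)` can be dropped from the homotopy relation, since `d x` lies in `N` and `T`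
-- preserves `N`.
include s in
lemma mem_of_isRelCycle {n : ℕ} {x : K.X n} (hx : IsRelCycle N x) :
    (K.d (n + 1) n).hom (s.T n x) - (x - s.S n x) ∈ N.carrier n := by
  cases n with
  | zero => exact s.mem_zero x
  | succ n =>
    have h := sub_mem (s.mem_succ n x) (s.T_mem _ _ (hx n))
    convert h using 1
    abel

/-- `Subdivision` has no chain map axiom for `S`. Applying `d` to the homotopy relation gives the
required compatibility, because `d² = 0`. -/
lemma isRelCycle_S {n : ℕ} {x : K.X n} (hx : IsRelCycle N x) : IsRelCycle N (s.S n x) := by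
  intro j
  have h := sub_mem (N.d_mem n j _ (s.mem_of_isRelCycle hx)) (hx j)
  rw [map_sub, map_sub, Subcomplex.d_d_apply] at h
  -- At this point `h` says that `d S x - 2 d x` lies in `N`.
  have h' := add_mem h (add_mem (hx j) (hx j))
  convert h' using 1
  abel

-- If `S^m x` lies in `N`, the telescoping sum `T x + T S x + … + T S^(m-1) x` has boundary `x`
-- modulo `N`. So the quotient of `K` by `N` is acyclic.
include s in
lemma exists_fill {n : ℕ} (x : K.X n) (hx : IsRelCycle N x) :
    ∃ z : K.X (n + 1), (K.d (n + 1) n).hom z - x ∈ N.carrier n := by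
  obtain ⟨m, hm⟩ := s.nilpotent n x
  induction m generalizing x with
  | zero => exact ⟨0, by simpa using hm⟩
  | succ m ih =>
    obtain ⟨z, hz⟩ := ih _ (s.isRelCycle_S hx) hm
    refine ⟨z + s.T n x, ?_⟩
    have h := add_mem hz (s.mem_of_isRelCycle hx)
    rw [map_add]
    convert h using 1
    abel

/-- An operator which vanishes on `N` and fills the cycles modulo `N`. -/
def IsFiller (N : Subcomplex K) {n : ℕ} (D : K.X n →+ K.X (n + 1)) : Prop :=
  (∀ x ∈ N.carrier n, D x = 0) ∧
    ∀ x, IsRelCycle N x → (K.d (n + 1) n).hom (D x) - x ∈ N.carrier n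

variable {B : ℕ → Type*} {e : ∀ n, B n → K.X n} {G : ∀ n, Set (B n)}

-- One step in the construction of a contraction: `R` is `Dd` for the operator `D` already built one
-- degree lower, and is `0` in degree `0`. Freeness permits an arbitrary choice of filler on each
-- basis element. As `N` is spanned by basis elements, the choice can be `0` there, which forces the
-- new operator to vanish on all of `N`.
include s in
lemma exists_lift_fill (he : ∀ n, IsFreeBasis (e n))
    (hG : ∀ n, N.carrier n = AddSubgroup.closure (e n '' G n)) {n : ℕ} (R : K.X n →+ K.X n)
    (hR : ∀ x, IsRelCycle N (x - R x)) (hRN : ∀ x ∈ N.carrier n, R x ∈ N.carrier n) :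
    ∃ D : K.X n →+ K.X (n + 1), (∀ x ∈ N.carrier n, D x = 0) ∧
      ∀ x, (K.d (n + 1) n).hom (D x) + R x - x ∈ N.carrier n := by
  classical
  choose z hz using fun b => s.exists_fill _ (hR (e n b))
  obtain ⟨D, hD⟩ := (he n).exists_lift fun b => if b ∈ G n then 0 else z b
  have hDN : ∀ x ∈ N.carrier n, D x = 0 := by
    intro x hx
    have : N.carrier n ≤ D.ker := by
      rw [hG, AddSubgroup.closure_le]
      rintro _ ⟨b, hb, rfl⟩
      exact (hD b).trans (if_pos hb)
    exact this hx
  refine ⟨D, hDN, fun x => ?_⟩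
  refine (he n).mem_of_forall
    ((N.carrier n).comap ((K.d (n + 1) n).hom.comp D + R - AddMonoidHom.id _)) (fun b => ?_) x
  change (K.d (n + 1) n).hom (D (e n b)) + R (e n b) - e n b ∈ N.carrier n
  by_cases hb : b ∈ G n
  · have hb' : e n b ∈ N.carrier n := by
      rw [hG]
      exact AddSubgroup.subset_closure (mem_image_of_mem _ hb)
    rw [hDN _ hb', map_zero, zero_add]
    exact sub_mem (hRN _ hb') hb'
  · rw [hD, if_neg hb]
    convert hz b using 1
    abel

include s in
lemma exists_filler_zero (he : ∀ n, IsFreeBasis (e n))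
    (hG : ∀ n, N.carrier n = AddSubgroup.closure (e n '' G n)) :
    ∃ D : K.X 0 →+ K.X 1, IsFiller N D ∧ ∀ x, (K.d 1 0).hom (D x) - x ∈ N.carrier 0 := by
  obtain ⟨D, h1, h2⟩ := s.exists_lift_fill he hG (n := 0) 0
    (fun x j => by
      rw [Subcomplex.d_shape_apply K (by simp)]
      exact zero_mem _)
    (fun _ _ => zero_mem _)
  have h3 : ∀ x, (K.d 1 0).hom (D x) - x ∈ N.carrier 0 := fun x => by simpa using h2 x
  exact ⟨D, ⟨h1, fun x _ => h3 x⟩, h3⟩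

-- `IsFiller` is the invariant of the recursion. Because `d x` is a cycle, `D` fills it, so `x - D d
-- x` is a cycle modulo `N` and can be filled in turn. If `x` is itself a cycle modulo `N`, then `D
-- d x = 0`, so the new operator is again a filler.
include s in
lemma exists_filler_succ (he : ∀ n, IsFreeBasis (e n))
    (hG : ∀ n, N.carrier n = AddSubgroup.closure (e n '' G n)) {n : ℕ}
    {D : K.X n →+ K.X (n + 1)} (hD : IsFiller N D) :
    ∃ D' : K.X (n + 1) →+ K.X (n + 2), IsFiller N D' ∧ ∀ x,
      (K.d (n + 2) (n + 1)).hom (D' x) + D ((K.d (n + 1) n).hom x) - x ∈ N.carrier (n + 1) := by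
  obtain ⟨D', h1, h2⟩ := s.exists_lift_fill he hG (n := n + 1) (D.comp (K.d (n + 1) n).hom)
    (fun x j => by
      by_cases hj : (ComplexShape.down ℕ).Rel (n + 1) j
      · obtain rfl : j = n := by simpa using hj
        have h := hD.2 ((K.d (j + 1) j).hom x) fun i => by
          rw [Subcomplex.d_d_apply]
          exact zero_mem _
        rw [← neg_mem_iff, ← map_neg, neg_sub, map_sub]
        exact h
      · rw [Subcomplex.d_shape_apply K hj]
        exact zero_mem _)
    (fun x hx => by
      change D _ ∈ _
      rw [hD.1 _ (N.d_mem _ _ _ hx)]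
      exact zero_mem _)
  refine ⟨D', ⟨h1, fun x hx => ?_⟩, h2⟩
  have h := h2 x
  rwa [AddMonoidHom.comp_apply, hD.1 _ (hx n), add_zero] at h

include s in
/-- A free complex with a subdivision can be deformed into the subcomplex, provided that the
subcomplex is spanned by basis elements. -/
lemma nonempty_deformation (he : ∀ n, IsFreeBasis (e n))
    (hG : ∀ n, N.carrier n = AddSubgroup.closure (e n '' G n)) : Nonempty (Deformation N) := by
  obtain ⟨D₀, h₀, h₀'⟩ := s.exists_filler_zero he hG
  choose next hnext hnext' using fun (n : ℕ) (D : {D : K.X n →+ K.X (n + 1) // IsFiller N D}) =>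
    s.exists_filler_succ he hG D.2
  -- The recursion runs over operators bundled with the filler property, so that each stage can
  -- supply the next.
  let D : ∀ n, {D : K.X n →+ K.X (n + 1) // IsFiller N D} := fun n =>
    Nat.rec ⟨D₀, h₀⟩ (fun n D => ⟨next n D, hnext n D⟩) n
  exact ⟨{
    D := fun n => (D n).1
    D_eq_zero := fun n => (D n).2.1
    mem_zero := h₀'
    mem_succ := fun n => hnext' n (D n) }⟩

end Subdivision

end Deformation

/-! ### Locally nilpotent endomorphisms modulo a subgroup -/

/-- The elements which are moved into `N` by the `m`-th iterate of `S`. -/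
def iterateComap {A : Type*} [AddCommGroup A] (S : A →+ A) (N : AddSubgroup A) (m : ℕ) :
    AddSubgroup A where
  carrier := {x | S^[m] x ∈ N}
  zero_mem' := by
    change S^[m] 0 ∈ N
    rw [iterate_map_zero]
    exact zero_mem _
  add_mem' {x y} hx hy := by
    change S^[m] (x + y) ∈ N
    rw [iterate_map_add]
    exact add_mem hx hy
  neg_mem' {x} hx := by
    change S^[m] (-x) ∈ N
    rw [iterate_map_neg]
    exact neg_mem hx

lemma mem_iterateComap {A : Type*} [AddCommGroup A] {S : A →+ A} {N : AddSubgroup A} {m : ℕ}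
    {x : A} : x ∈ iterateComap S N m ↔ S^[m] x ∈ N := Iff.rfl

lemma iterateComap_mono {A : Type*} [AddCommGroup A] {S : A →+ A} {N : AddSubgroup A}
    (hS : ∀ x ∈ N, S x ∈ N) : Monotone (iterateComap S N) := by
  refine monotone_nat_of_le_succ fun m x hx => ?_
  rw [mem_iterateComap, Function.iterate_succ_apply']
  exact hS _ hx

/-- The exponent may vary with the basis element. The subgroups `iterateComap S N m` increase with
`m`, so their union is a subgroup, and it contains the basis. -/
lemma IsFreeBasis.exists_iterate_mem {B : Type*} {A : Type*} [AddCommGroup A] {e : B → A}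
    (he : IsFreeBasis e) {S : A →+ A} {N : AddSubgroup A} (hS : ∀ x ∈ N, S x ∈ N)
    (h : ∀ b, ∃ m : ℕ, S^[m] (e b) ∈ N) (x : A) : ∃ m : ℕ, S^[m] x ∈ N := by
  have hx : x ∈ ⨆ m, iterateComap S N m := he.mem_of_forall _ (fun b => by
    obtain ⟨m, hm⟩ := h b
    exact AddSubgroup.mem_iSup_of_mem m hm) x
  rwa [AddSubgroup.mem_iSup_of_directed (iterateComap_mono hS).directed_le] at hx

lemma map_mem_of_closure {A A' : Type*} [AddCommGroup A] [AddCommGroup A'] {N : AddSubgroup A}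
    {s : Set A} (hN : N = AddSubgroup.closure s) (F : A →+ A') (H : AddSubgroup A')
    (h : ∀ x ∈ s, F x ∈ H) (x : A) (hx : x ∈ N) : F x ∈ H := by
  subst hN
  exact (AddSubgroup.closure_le (H.comap F)).2 h hx

/-! ### Fine maps -/

section Fine

variable {X : Type u} [ClosureSpace X] {ι : Type v} {U : ι → Set X}

lemma exists_mem_nhd (hU : IsInteriorCover U) (x : X) : ∃ j, U j ∈ nhd x := by
  have hx : x ∈ ⋃ j, intr (U j) := by rw [hU]; trivial
  exact mem_iUnion.1 hx

/-- The map `f` sends each ball of radius `δ` into a member of `U`. -/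
def IsFine (U : ι → Set X) {Z : Type*} [PseudoMetricSpace Z] (δ : ℝ) (f : Z → X) : Prop :=
  ∀ x, ∃ j, ∀ y, dist y x ≤ δ → f y ∈ U j

omit [ClosureSpace X] in
lemma IsFine.mono {Z : Type*} [PseudoMetricSpace Z] {δ δ' : ℝ} {f : Z → X} (h : IsFine U δ f)
    (hδ : δ' ≤ δ) : IsFine U δ' f := fun x =>
  (h x).imp fun _ hj y hy => hj y (hy.trans hδ)

/-- The preimages of the `U j` need not be open. Continuity puts each point in the topological
interior of one of them, and these interiors have a Lebesgue number. -/
lemma exists_isFine (hU : IsInteriorCover U) {Z : Type*} [PseudoMetricSpace Z] [CompactSpace Z]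
    {f : Z → X} (hf : ∀ z, Filter.Tendsto f (nhds z) (nhd (f z))) : ∃ δ > 0, IsFine U δ f := by
  obtain ⟨δ, hδ, h⟩ := lebesgue_number_lemma_of_metric (s := (univ : Set Z))
    (c := fun j => interior (f ⁻¹' U j)) isCompact_univ (fun _ => isOpen_interior)
    (fun z _ => by
      obtain ⟨j, hj⟩ := exists_mem_nhd hU (f z)
      exact mem_iUnion.2 ⟨j, mem_interior_iff_mem_nhds.2 (hf z hj)⟩)
  -- The Lebesgue number concerns open balls and `IsFine` closed ones; halving fits the latter into
  -- the former.
  refine ⟨δ / 2, half_pos hδ, fun x => ?_⟩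
  obtain ⟨j, hj⟩ := h x trivial
  exact ⟨j, fun y hy => interior_subset (s := f ⁻¹' U j) (hj (hy.trans_lt (half_lt_self hδ)))⟩

lemma nhd_ofTopology {Y : Type*} [TopologicalSpace Y] (y : Y) :
    @nhd Y (ofTopology Y) y = nhds y := by
  ext V
  change y ∈ (closure Vᶜ)ᶜ ↔ _
  rw [closure_compl, compl_compl, mem_interior_iff_mem_nhds]

end Fine

/-! ### Subdivision of cubes -/

section Cubes

noncomputable instance : MetricSpace Interval.I.Pt := inferInstanceAs (MetricSpace unitInterval)

instance : CompactSpace Interval.I.Pt := inferInstanceAs (CompactSpace unitInterval)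

/-- The inclusion of the unit interval into the real line. -/
def Interval.val (t : Interval.I.Pt) : ℝ := Subtype.val (p := fun t => t ∈ unitInterval) t

namespace Interval

lemma val_injective : Function.Injective val := Subtype.val_injective

lemma isEmbedding_val : Topology.IsEmbedding val := Topology.IsEmbedding.subtypeVal

lemma val_zero : val I.zero = 0 := rfl

lemma val_one : val I.one = 1 := rfl

lemma val_nonneg (t : I.Pt) : 0 ≤ val t := t.2.1

lemma val_le_one (t : I.Pt) : val t ≤ 1 := t.2.2

lemma dist_eq (s t : I.Pt) : dist s t = |val s - val t| := rfl

lemma nhd_pt (t : I.Pt) : nhd t = nhds t := nhd_ofTopology (Y := unitInterval) t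

/-- The product closure on the cube agrees with the product topology, so compactness and the sup
metric become available. -/
lemma nhd_cube {n : ℕ} (x : I.Cube n) : nhd x = nhds x := by
  rw [nhd_pi, nhds_pi]
  congr 1
  funext i
  exact nhd_pt (x i)

end Interval

open CechClosure.Interval (val)

/-- For `b = false` the interval is shrunk linearly from `[0, 1]` to `[0, 1/2]` as `s` goes from
`0` to `1`, and for `b = true` it is expanded from `[1, 1]` to `[1/2, 1]`. -/
noncomputable def glide (b : Bool) (s t : Interval.I.Pt) : Interval.I.Pt :=
  (⟨if b then 1 - val s / 2 * (1 - val t) else val t * (1 - val s / 2), by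
    have hs := Interval.val_nonneg s
    have hs' := Interval.val_le_one s
    have ht := Interval.val_nonneg t
    have ht' := Interval.val_le_one t
    simp only [mem_Icc]
    split_ifs <;> constructor <;> nlinarith⟩ : unitInterval)

lemma val_glide_true (s t : Interval.I.Pt) :
    val (glide true s t) = 1 - val s / 2 * (1 - val t) := rfl

lemma val_glide_false (s t : Interval.I.Pt) :
    val (glide false s t) = val t * (1 - val s / 2) := rfl

lemma glide_false_zero_left (t : Interval.I.Pt) : glide false Interval.I.zero t = t :=
  Interval.val_injective (by simp [val_glide_false, Interval.val_zero])

lemma glide_true_zero_left (t : Interval.I.Pt) :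
    glide true Interval.I.zero t = Interval.I.one :=
  Interval.val_injective (by simp [val_glide_true, Interval.val_zero, Interval.val_one])

lemma glide_false_zero (s : Interval.I.Pt) : glide false s Interval.I.zero = Interval.I.zero :=
  Interval.val_injective (by simp [val_glide_false, Interval.val_zero])

lemma glide_true_one (s : Interval.I.Pt) : glide true s Interval.I.one = Interval.I.one :=
  Interval.val_injective (by simp [val_glide_true, Interval.val_one])

/-- At every time `s` the two pieces of the interval meet at `1 - s / 2`. This is the source of the
cancellation of inner faces. -/
lemma glide_false_one (s : Interval.I.Pt) :
    glide false s Interval.I.one = glide true s Interval.I.zero :=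
  Interval.val_injective
    (by simp [val_glide_false, val_glide_true, Interval.val_zero, Interval.val_one])

lemma continuous_glide (b : Bool) :
    Continuous fun p : Interval.I.Pt × Interval.I.Pt => glide b p.1 p.2 := by
  have hv := Interval.isEmbedding_val.continuous
  rw [Interval.isEmbedding_val.continuous_iff]
  cases b
  · change Continuous fun p : Interval.I.Pt × Interval.I.Pt => val p.2 * (1 - val p.1 / 2)
    fun_prop
  · change Continuous fun p : Interval.I.Pt × Interval.I.Pt => 1 - val p.1 / 2 * (1 - val p.2)
    fun_prop

lemma dist_glide_one (b : Bool) (t t' : Interval.I.Pt) :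
    dist (glide b Interval.I.one t) (glide b Interval.I.one t') = dist t t' / 2 := by
  have h : ∀ x : ℝ, |x| / 2 = |x / 2| := fun x => by rw [abs_div, abs_two]
  rw [Interval.dist_eq, Interval.dist_eq, h]
  cases b
  · rw [val_glide_false, val_glide_false, Interval.val_one]
    congr 1
    ring
  · rw [val_glide_true, val_glide_true, Interval.val_one]
    congr 1
    ring

/-- A family of pieces of the homotopy from a cube to its subdivision. -/
noncomputable def glideCube {n : ℕ} (ε : Fin n → Bool) :
    ContMap (Interval.I.Cube (n + 1)) (Interval.I.Cube n) where
  toFun a i := glide (ε i) (a 0) (a i.succ)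
  cont := by
    rw [isCont_iff_tendsto]
    intro x
    rw [Interval.nhd_cube, Interval.nhd_cube]
    refine Continuous.tendsto (continuous_pi fun i => ?_) x
    have h : Continuous fun a : Interval.I.Cube (n + 1) => (a 0, a i.succ) :=
      (continuous_apply 0).prodMk (continuous_apply i.succ)
    exact (continuous_glide (ε i)).comp h

variable {X : Type u} [ClosureSpace X] {ι : Type v} {U : ι → Set X}

lemma isFreeBasis_cubeChain (J : Interval) (n : ℕ) :
    IsFreeBasis (cubeChain : ContMap (J.Cube n) X → _) :=
  ⟨AddEquiv.refl _, fun _ => rfl⟩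

/-- The part of the subdivision of a cube which is indexed by `ε`. -/
noncomputable def subcube {n : ℕ} (ε : Fin n → Bool) (σ : ContMap (Interval.I.Cube n) X) :
    ContMap (Interval.I.Cube n) X :=
  cubeFaceMap 0 Interval.I.one (σ.comp (glideCube ε))

lemma subcube_apply {n : ℕ} (ε : Fin n → Bool) (σ : ContMap (Interval.I.Cube n) X)
    (a : Interval.I.Cube n) :
    (subcube ε σ).toFun a = σ.toFun fun i => glide (ε i) Interval.I.one (a i) := by
  change σ.toFun _ = _
  congr 1

lemma face_zero_glideCube_apply {n : ℕ} (ε : Fin n → Bool) (σ : ContMap (Interval.I.Cube n) X)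
    (a : Interval.I.Cube n) :
    (cubeFaceMap 0 Interval.I.zero (σ.comp (glideCube ε))).toFun a =
      σ.toFun fun i => glide (ε i) Interval.I.zero (a i) := by
  change σ.toFun _ = _
  congr 1

lemma face_succ_glideCube_apply {n : ℕ} (i : Fin (n + 1)) (u : Interval.I.Pt) (b : Bool)
    (ε : Fin n → Bool) (σ : ContMap (Interval.I.Cube (n + 1)) X) (a : Interval.I.Cube (n + 1)) :
    (cubeFaceMap i.succ u (σ.comp (glideCube (i.insertNth b ε)))).toFun a =
      σ.toFun (i.insertNth (α := fun _ => Interval.I.Pt) (glide b (a 0) u)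
        ((glideCube ε).toFun a)) := by
  change σ.toFun _ = _
  congr 1
  change (fun j => glide (i.insertNth (α := fun _ => Bool) b ε j)
    (i.succ.insertNth (α := fun _ => Interval.I.Pt) u a 0)
    (i.succ.insertNth (α := fun _ => Interval.I.Pt) u a j.succ)) = _
  have h0 : i.succ.insertNth (α := fun _ => Interval.I.Pt) u a 0 = a 0 := by
    have := Fin.insertNth_apply_succAbove (α := fun _ => Interval.I.Pt) i.succ u a 0
    rwa [Fin.succ_succAbove_zero] at this
  funext j
  rw [h0]
  refine Fin.succAboveCases i ?_ (fun j => ?_) j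
  · rw [Fin.insertNth_apply_same, Fin.insertNth_apply_same, Fin.insertNth_apply_same]
  · have hj : i.succ.insertNth (α := fun _ => Interval.I.Pt) u a (i.succAbove j).succ =
        a j.succ := by
      have := Fin.insertNth_apply_succAbove (α := fun _ => Interval.I.Pt) i.succ u a j.succ
      rwa [Fin.succ_succAbove_succ] at this
    rw [Fin.insertNth_apply_succAbove, Fin.insertNth_apply_succAbove, hj]
    rfl

/-- For an end of a piece that stays at `v` for all times, the face of the homotopy is the homotopy
of the face. This covers the outer faces, which are `u = v = 0` with `b = false` and `u = v = 1`
with `b = true`. -/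
lemma face_succ_glideCube {n : ℕ} {i : Fin (n + 1)} {u v : Interval.I.Pt} {b : Bool}
    (h : ∀ s, glide b s u = v)
    (ε : Fin n → Bool) (σ : ContMap (Interval.I.Cube (n + 1)) X) :
    cubeFaceMap i.succ u (σ.comp (glideCube (i.insertNth b ε))) =
      (cubeFaceMap i v σ).comp (glideCube ε) := by
  apply ContMap.ext
  funext a
  rw [face_succ_glideCube_apply, h]
  rfl

lemma face_succ_glideCube_inner {n : ℕ} (i : Fin (n + 1))
    (ε : Fin n → Bool) (σ : ContMap (Interval.I.Cube (n + 1)) X) :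
    cubeFaceMap i.succ Interval.I.one (σ.comp (glideCube (i.insertNth false ε))) =
      cubeFaceMap i.succ Interval.I.zero (σ.comp (glideCube (i.insertNth true ε))) := by
  apply ContMap.ext
  funext a
  refine (face_succ_glideCube_apply i Interval.I.one false ε σ a).trans ?_
  rw [glide_false_one]
  exact (face_succ_glideCube_apply i Interval.I.zero true ε σ a).symm

/-- Group the pieces in pairs that differ only in the `i`-th direction. The face shared by a pair
cancels, and the two outer faces are pieces for the faces of `σ`. This identifies the spatial part
of `dT` with the terms of `Td`. -/
lemma sum_face_succ_glideCube {n : ℕ} (i : Fin (n + 1))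
    (σ : ContMap (Interval.I.Cube (n + 1)) X) :
    ∑ ε : Fin (n + 1) → Bool,
      (cubeChain (cubeFaceMap i.succ Interval.I.zero (σ.comp (glideCube ε))) -
        cubeChain (cubeFaceMap i.succ Interval.I.one (σ.comp (glideCube ε)))) =
    ∑ ε : Fin n → Bool,
      (cubeChain ((cubeFaceMap i Interval.I.zero σ).comp (glideCube ε)) -
        cubeChain ((cubeFaceMap i Interval.I.one σ).comp (glideCube ε))) := by
  rw [← (Fin.insertNthEquiv (fun _ => Bool) i).sum_comp, Fintype.sum_prod_type_right]
  refine Fintype.sum_congr _ _ fun ε => ?_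
  rw [Fintype.sum_bool]
  change cubeChain (cubeFaceMap i.succ Interval.I.zero (σ.comp (glideCube (i.insertNth true ε)))) -
      cubeChain (cubeFaceMap i.succ Interval.I.one (σ.comp (glideCube (i.insertNth true ε)))) +
    (cubeChain (cubeFaceMap i.succ Interval.I.zero (σ.comp (glideCube (i.insertNth false ε)))) -
      cubeChain (cubeFaceMap i.succ Interval.I.one (σ.comp (glideCube (i.insertNth false ε))))) = _
  have h0 : cubeFaceMap i.succ Interval.I.zero (σ.comp (glideCube (i.insertNth false ε))) =
      (cubeFaceMap i Interval.I.zero σ).comp (glideCube ε) :=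
    face_succ_glideCube glide_false_zero ε σ
  have h1 : cubeFaceMap i.succ Interval.I.one (σ.comp (glideCube (i.insertNth true ε))) =
      (cubeFaceMap i Interval.I.one σ).comp (glideCube ε) :=
    face_succ_glideCube glide_true_one ε σ
  rw [h0, h1, face_succ_glideCube_inner]
  abel

/-- The subcomplex generated by the small and the degenerate cubes. -/
noncomputable def smallOrDegenerate (J : Interval) (U : ι → Set X) :
    Subcomplex (unnormalizedCubicalChains J X) where
  carrier n := (smallUnnormalizedCubicalChains J U).carrier n ⊔ (degenerateChains J X).carrier n
  d_mem i j x hx := by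
    obtain ⟨y, hy, z, hz, rfl⟩ := AddSubgroup.mem_sup.1 hx
    rw [map_add]
    exact add_mem (AddSubgroup.mem_sup_left (Subcomplex.d_mem _ i j y hy))
      (AddSubgroup.mem_sup_right (Subcomplex.d_mem _ i j z hz))

/-- Being spanned by part of the basis of cubes is what the construction of a deformation requires.
In the unnormalized complex this is immediate, and no basis of the normalized complex is needed. -/
lemma smallOrDegenerate_carrier (J : Interval) (n : ℕ) :
    (smallOrDegenerate J U).carrier n = AddSubgroup.closure
      (cubeChain '' {σ : ContMap (J.Cube n) X | IsSmall U σ.toFun ∨ IsDegenerate σ}) := by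
  change AddSubgroup.closure _ ⊔ AddSubgroup.closure _ = _
  rw [← AddSubgroup.closure_union]
  congr 1
  ext x
  constructor
  · rintro (⟨σ, h, rfl⟩ | ⟨σ, h, rfl⟩)
    · exact ⟨σ, Or.inl h, rfl⟩
    · exact ⟨σ, Or.inr h, rfl⟩
  · rintro ⟨σ, h | h, rfl⟩
    · exact Or.inl ⟨σ, h, rfl⟩
    · exact Or.inr ⟨σ, h, rfl⟩

lemma IsSmall.cubeChain_mem {J : Interval} {n : ℕ} {σ : ContMap (J.Cube n) X}
    (h : IsSmall U σ.toFun) : cubeChain σ ∈ (smallOrDegenerate J U).carrier n := by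
  rw [smallOrDegenerate_carrier]
  exact AddSubgroup.subset_closure ⟨σ, Or.inl h, rfl⟩

lemma IsDegenerate.cubeChain_mem {J : Interval} {n : ℕ} {σ : ContMap (J.Cube n) X}
    (h : IsDegenerate σ) : cubeChain σ ∈ (smallOrDegenerate J U).carrier n := by
  rw [smallOrDegenerate_carrier]
  exact AddSubgroup.subset_closure ⟨σ, Or.inr h, rfl⟩

lemma IsDegenerate.glideCube {n : ℕ} {σ : ContMap (Interval.I.Cube n) X} (h : IsDegenerate σ)
    (ε : Fin n → Bool) : IsDegenerate (σ.comp (glideCube ε)) := by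
  obtain ⟨i, hi⟩ := h
  refine ⟨i.succ, fun a b hab => hi _ _ fun k hk => ?_⟩
  change glide _ (a 0) (a k.succ) = glide _ (b 0) (b k.succ)
  rw [hab 0 (Fin.succ_ne_zero i).symm, hab k.succ fun h => hk (Fin.succ_injective _ h)]

lemma IsDegenerate.subcube {n : ℕ} {σ : ContMap (Interval.I.Cube n) X} (h : IsDegenerate σ)
    (ε : Fin n → Bool) : IsDegenerate (subcube ε σ) := by
  obtain ⟨i, hi⟩ := h
  refine ⟨i, fun a b hab => ?_⟩
  rw [subcube_apply, subcube_apply]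
  exact hi _ _ fun k hk => by rw [hab k hk]

/-- At time `0` the piece with all signs `false` is `σ` itself. Any other piece has a direction
collapsed to the endpoint `1` and is degenerate. Only here does the homotopy relation fail to be
exact. -/
lemma sum_face_zero_glideCube_sub_mem {n : ℕ} (σ : ContMap (Interval.I.Cube n) X) :
    ∑ ε : Fin n → Bool, cubeChain (cubeFaceMap 0 Interval.I.zero (σ.comp (glideCube ε))) -
      cubeChain σ ∈ (smallOrDegenerate Interval.I U).carrier n := by
  have h : cubeFaceMap 0 Interval.I.zero (σ.comp (glideCube fun _ => false)) = σ := by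
    apply ContMap.ext
    funext a
    rw [face_zero_glideCube_apply]
    congr 1
    funext i
    exact glide_false_zero_left (a i)
  rw [← Finset.add_sum_erase _ _ (Finset.mem_univ fun _ => false), h, add_sub_cancel_left]
  refine sum_mem fun ε hε => IsDegenerate.cubeChain_mem ?_
  obtain ⟨i, hi⟩ := Function.ne_iff.1 (Finset.ne_of_mem_erase hε)
  refine ⟨i, fun a b hab => ?_⟩
  rw [face_zero_glideCube_apply, face_zero_glideCube_apply]
  congr 1
  funext k
  by_cases hk : k = i
  · subst hk
    rw [Bool.eq_true_of_not_eq_false hi, glide_true_zero_left, glide_true_zero_left]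
  · rw [hab k hk]

omit [ClosureSpace X] in
lemma IsFine.isSmall_of_one_le {n : ℕ} {f : Interval.I.Cube n → X} (h : IsFine U 1 f) :
    IsSmall U f := by
  obtain ⟨j, hj⟩ := h fun _ => Interval.I.zero
  refine ⟨j, ?_⟩
  rintro _ ⟨y, rfl⟩
  refine hj y ((dist_pi_le_iff zero_le_one).2 fun i => ?_)
  rw [Interval.dist_eq, Interval.val_zero, sub_zero, abs_of_nonneg (Interval.val_nonneg _)]
  exact Interval.val_le_one _

/-- At time `1` every piece is traversed at half scale, so subdividing doubles the radius of
fineness. -/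
lemma IsFine.subcube {n : ℕ} {σ : ContMap (Interval.I.Cube n) X} {δ : ℝ} (hδ : 0 ≤ δ)
    (h : IsFine U (δ / 2) σ.toFun) (ε : Fin n → Bool) :
    IsFine U δ (subcube ε σ).toFun := by
  intro x
  obtain ⟨j, hj⟩ := h fun i => glide (ε i) Interval.I.one (x i)
  refine ⟨j, fun y hy => ?_⟩
  rw [subcube_apply]
  refine hj _ ((dist_pi_le_iff (by positivity)).2 fun i => ?_)
  rw [dist_glide_one]
  have := (dist_le_pi_dist y x i).trans hy
  linarith

lemma nonempty_subdivision_smallOrDegenerate (hU : IsInteriorCover U) :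
    Nonempty (Subdivision (smallOrDegenerate Interval.I U)) := by
  choose S hS using fun n => (isFreeBasis_cubeChain (X := X) Interval.I n).exists_lift
    fun σ => ∑ ε : Fin n → Bool, cubeChain (subcube ε σ)
  -- Time is coordinate `0` of the homotopy, and the cubical boundary gives that coordinate the sign
  -- `-1`. The minus sign here makes `dT` start with the time `0` face minus the time `1` face.
  choose T hT using fun n => (isFreeBasis_cubeChain (X := X) Interval.I n).exists_lift
    fun σ => -∑ ε : Fin n → Bool, cubeChain (σ.comp (glideCube ε))
  have S_mem : ∀ n, ∀ x ∈ (smallOrDegenerate Interval.I U).carrier n,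
      S n x ∈ (smallOrDegenerate Interval.I U).carrier n := by
    refine fun n => map_mem_of_closure (smallOrDegenerate_carrier Interval.I n) _ _ ?_
    rintro _ ⟨σ, hσ, rfl⟩
    rw [hS]
    refine sum_mem fun ε _ => ?_
    rcases hσ with hσ | hσ
    · exact IsSmall.cubeChain_mem ((hσ.comp _).comp _)
    · exact (hσ.subcube ε).cubeChain_mem
  have T_mem : ∀ n, ∀ x ∈ (smallOrDegenerate Interval.I U).carrier n,
      T n x ∈ (smallOrDegenerate Interval.I U).carrier (n + 1) := by
    refine fun n => map_mem_of_closure (smallOrDegenerate_carrier Interval.I n) _ _ ?_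
    rintro _ ⟨σ, hσ, rfl⟩
    rw [hT]
    refine neg_mem (sum_mem fun ε _ => ?_)
    rcases hσ with hσ | hσ
    · exact IsSmall.cubeChain_mem (hσ.comp _)
    · exact (hσ.glideCube ε).cubeChain_mem
  have dT : ∀ n (σ : ContMap (Interval.I.Cube n) X),
      ((unnormalizedCubicalChains Interval.I X).d (n + 1) n).hom (T n (cubeChain σ)) =
        ∑ ε : Fin n → Bool, cubeChain (cubeFaceMap 0 Interval.I.zero (σ.comp (glideCube ε))) -
          S n (cubeChain σ) - ∑ i : Fin n, (-1 : ℤ) ^ (i : ℕ) • ∑ ε : Fin n → Bool,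
            (cubeChain (cubeFaceMap i.succ Interval.I.zero (σ.comp (glideCube ε))) -
              cubeChain (cubeFaceMap i.succ Interval.I.one (σ.comp (glideCube ε)))) := by
    intro n σ
    rw [hT, hS, map_neg, map_sum]
    simp only [unnormalizedCubicalChains_d, Fin.sum_univ_succ, Finset.sum_add_distrib,
      Finset.smul_sum]
    rw [Finset.sum_comm]
    simp only [Fin.val_zero, Fin.val_succ, pow_succ, pow_zero, mul_neg, mul_one, neg_neg,
      neg_smul, one_smul, Finset.sum_neg_distrib, Finset.sum_sub_distrib, smul_sub, subcube]
    abel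
  refine ⟨⟨S, T, S_mem, T_mem, fun x => ?_, fun n x => ?_, fun n => ?_⟩⟩
  · refine (isFreeBasis_cubeChain Interval.I 0).mem_of_forall
      (((smallOrDegenerate Interval.I U).carrier 0).comap
        (((unnormalizedCubicalChains Interval.I X).d 1 0).hom.comp (T 0) -
          (AddMonoidHom.id _ - S 0))) (fun σ => ?_) x
    change ((unnormalizedCubicalChains Interval.I X).d 1 0).hom (T 0 (cubeChain σ)) -
      (cubeChain σ - S 0 (cubeChain σ)) ∈ (smallOrDegenerate Interval.I U).carrier 0
    rw [dT]
    convert sum_face_zero_glideCube_sub_mem (U := U) σ using 1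
    simp only [Finset.univ_eq_empty, Finset.sum_empty]
    abel
  · refine (isFreeBasis_cubeChain Interval.I (n + 1)).mem_of_forall
      (((smallOrDegenerate Interval.I U).carrier (n + 1)).comap
        (((unnormalizedCubicalChains Interval.I X).d (n + 2) (n + 1)).hom.comp (T (n + 1)) +
          (T n).comp ((unnormalizedCubicalChains Interval.I X).d (n + 1) n).hom -
          (AddMonoidHom.id _ - S (n + 1)))) (fun σ => ?_) x
    change ((unnormalizedCubicalChains Interval.I X).d (n + 2) (n + 1)).hom
        (T (n + 1) (cubeChain σ)) +
      T n (((unnormalizedCubicalChains Interval.I X).d (n + 1) n).hom (cubeChain σ)) -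
      (cubeChain σ - S (n + 1) (cubeChain σ)) ∈
        (smallOrDegenerate Interval.I U).carrier (n + 1)
    -- The spatial face `i` is coordinate `i.succ` in `dT`, so its sign there is opposite to the one
    -- here and the two sums cancel.
    have hTd : T n (((unnormalizedCubicalChains Interval.I X).d (n + 1) n).hom (cubeChain σ)) =
        ∑ i : Fin (n + 1), (-1 : ℤ) ^ (i : ℕ) • ∑ ε : Fin n → Bool,
          (cubeChain ((cubeFaceMap i Interval.I.zero σ).comp (glideCube ε)) -
            cubeChain ((cubeFaceMap i Interval.I.one σ).comp (glideCube ε))) := by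
      rw [unnormalizedCubicalChains_d, map_sum]
      refine Fintype.sum_congr _ _ fun i => ?_
      rw [map_zsmul, map_sub, hT, hT, pow_succ, mul_neg, mul_one, neg_smul, ← smul_neg,
        Finset.sum_sub_distrib]
      congr 1
      abel
    rw [dT, hTd]
    convert sum_face_zero_glideCube_sub_mem (U := U) σ using 1
    simp only [sum_face_succ_glideCube]
    abel
  · refine (isFreeBasis_cubeChain Interval.I n).exists_iterate_mem (S_mem n) fun σ => ?_
    -- Each subdivision trades one factor `1 / 2` of the radius for one application of `S`. At
    -- radius `1` the ball about the origin is the whole cube.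
    have key : ∀ (m : ℕ) (σ : ContMap (Interval.I.Cube n) X),
        IsFine U ((1 / 2) ^ m) σ.toFun →
        cubeChain σ ∈ iterateComap (S n) ((smallOrDegenerate Interval.I U).carrier n) m := by
      intro m
      induction m with
      | zero =>
        exact fun σ hσ => IsSmall.cubeChain_mem (IsFine.isSmall_of_one_le (by simpa using hσ))
      | succ m ih =>
        intro σ hσ
        have h : S n (cubeChain σ) ∈
            iterateComap (S n) ((smallOrDegenerate Interval.I U).carrier n) m := by
          rw [hS]
          refine sum_mem fun ε _ => ih _ (IsFine.subcube (by positivity) ?_ ε)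
          rwa [pow_succ, mul_one_div] at hσ
        exact h
    obtain ⟨δ, hδ, h⟩ := exists_isFine hU (f := σ.toFun) fun z => by
      have := isCont_iff_tendsto.1 σ.cont z
      rwa [Interval.nhd_cube] at this
    obtain ⟨m, hm⟩ := exists_pow_lt_of_lt_one hδ (one_half_lt_one (α := ℝ))
    exact ⟨m, key m σ (h.mono hm.le)⟩

end Cubes

/-! ### Passage to normalized cubical chains -/

/-- A deformation into `M + N` descends to the quotient by `N`. -/
noncomputable def Deformation.mapQuotient {K : ChainComplex AddCommGrpCat.{u} ℕ}
    {L M N : Subcomplex K} (h : Deformation L)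
    (hL : ∀ n, L.carrier n = M.carrier n ⊔ N.carrier n) : Deformation (M.mapQuotient N) where
  D n := QuotientAddGroup.map (N.carrier n) (N.carrier (n + 1)) (h.D n) fun x hx => by
    change h.D n x ∈ N.carrier (n + 1)
    rw [h.D_eq_zero n x (by rw [hL]; exact AddSubgroup.mem_sup_right hx)]
    exact zero_mem _
  D_eq_zero := by
    rintro n _ ⟨x, hx, rfl⟩
    change QuotientAddGroup.mk (h.D n x) = 0
    rw [h.D_eq_zero n x (by rw [hL]; exact AddSubgroup.mem_sup_left hx)]
    rfl
  mem_zero x := by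
    obtain ⟨x, rfl⟩ := QuotientAddGroup.mk_surjective x
    have hx := h.mem_zero x
    rw [hL] at hx
    obtain ⟨y, hy, z, hz, hyz⟩ := AddSubgroup.mem_sup.1 hx
    refine ⟨y, hy, ?_⟩
    change QuotientAddGroup.mk y = QuotientAddGroup.mk ((K.d 1 0).hom (h.D 0 x) - x)
    rw [← hyz, QuotientAddGroup.mk_add, (QuotientAddGroup.eq_zero_iff z).2 hz, add_zero]
  mem_succ n x := by
    obtain ⟨x, rfl⟩ := QuotientAddGroup.mk_surjective x
    have hx := h.mem_succ n x
    rw [hL] at hx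
    obtain ⟨y, hy, z, hz, hyz⟩ := AddSubgroup.mem_sup.1 hx
    refine ⟨y, hy, ?_⟩
    change QuotientAddGroup.mk y = QuotientAddGroup.mk
      ((K.d (n + 2) (n + 1)).hom (h.D (n + 1) x) + h.D n ((K.d (n + 1) n).hom x) - x)
    rw [← hyz, QuotientAddGroup.mk_add, (QuotientAddGroup.eq_zero_iff z).2 hz, add_zero]

lemma nonempty_deformation_smallCubicalChains {X : Type u} [ClosureSpace X] {ι : Type v}
    {U : ι → Set X} (hU : IsInteriorCover U) :
    Nonempty (Deformation (smallCubicalChains Interval.I U)) := by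
  obtain ⟨s⟩ := nonempty_subdivision_smallOrDegenerate hU
  obtain ⟨h⟩ := s.nonempty_deformation (isFreeBasis_cubeChain Interval.I)
    (smallOrDegenerate_carrier Interval.I)
  exact ⟨h.mapQuotient fun _ => rfl⟩

/-! ### Chains on tuples and barycentric subdivision -/

section Tuples

/-- The homomorphism from a free abelian group with given values on the basis. -/
noncomputable def freeLift {B A : Type*} [AddCommGroup A] (f : B → A) : (B →₀ ℤ) →+ A :=
  Finsupp.liftAddHom fun b => zmultiplesHom A (f b)

lemma freeLift_single {B A : Type*} [AddCommGroup A] (f : B → A) (b : B) :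
    freeLift f (Finsupp.single b 1) = f b := by
  simp [freeLift]

lemma isFreeBasis_single (B : Type*) :
    IsFreeBasis fun b : B => (Finsupp.single b 1 : B →₀ ℤ) :=
  ⟨AddEquiv.refl _, fun _ => rfl⟩

lemma IsFreeBasis.hom_ext {B A A' : Type*} [AddCommGroup A] [AddCommGroup A'] {e : B → A}
    (he : IsFreeBasis e) {F F' : A →+ A'} (h : ∀ b, F (e b) = F' (e b)) (x : A) : F x = F' x :=
  he.mem_of_forall (F.eqLocus F') h x

/-- The free abelian group on the tuples of length `k`. -/
abbrev TupleChains (Y : Type*) (k : ℕ) : Type _ := (Fin k → Y) →₀ ℤ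

namespace TupleChains

variable {Y Y' : Type*}

/-- A tuple as a chain. -/
noncomputable abbrev tuple {k : ℕ} (v : Fin k → Y) : TupleChains Y k := Finsupp.single v 1

/-- The map which omits the `i`-th entry. -/
noncomputable def face {k : ℕ} (i : Fin (k + 1)) : TupleChains Y (k + 1) →+ TupleChains Y k :=
  freeLift fun v => tuple fun j => v (i.succAbove j)

lemma face_tuple {k : ℕ} (i : Fin (k + 1)) (v : Fin (k + 1) → Y) :
    face i (tuple v) = tuple fun j => v (i.succAbove j) := freeLift_single _ _

/-- The boundary of the augmented complex of tuples. -/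
noncomputable def boundary (k : ℕ) : TupleChains Y (k + 1) →+ TupleChains Y k :=
  ∑ i : Fin (k + 1), (-1 : ℤ) ^ (i : ℕ) • face i

lemma boundary_apply {k : ℕ} (x : TupleChains Y (k + 1)) :
    boundary k x = ∑ i : Fin (k + 1), (-1 : ℤ) ^ (i : ℕ) • face i x := by
  simp only [boundary, AddMonoidHom.finsetSum_apply, AddMonoidHom.smul_apply]

lemma face_face {k : ℕ} {i j : Fin (k + 1)} (h : i ≤ j) (x : TupleChains Y (k + 2)) :
    face i (face j.succ x) = face j (face i.castSucc x) := by
  refine (isFreeBasis_single _).hom_ext (F := (face i).comp (face j.succ))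
    (F' := (face j).comp (face i.castSucc)) (fun v => ?_) x
  change face i (face j.succ (tuple v)) = face j (face i.castSucc (tuple v))
  simp only [face_tuple]
  congr 1
  funext l
  congr 1
  have hij : (i : ℕ) ≤ j := h
  have hv : ∀ {m : ℕ} (p : Fin (m + 1)) (q : Fin m),
      (p.succAbove q : ℕ) = if (q : ℕ) < p then (q : ℕ) else q + 1 := by
    intro m p q
    rw [Fin.succAbove, apply_ite Fin.val]
    rfl
  rw [Fin.ext_iff, hv, hv, hv, hv, Fin.val_succ, Fin.val_castSucc]
  split_ifs <;> omega

lemma boundary_boundary {k : ℕ} (x : TupleChains Y (k + 2)) :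
    boundary k (boundary (k + 1) x) = 0 := by
  rw [← sum_alternating_eq_zero (fun i j => face i (face j x)) (fun i j h => face_face h x)]
  simp only [boundary_apply, map_sum, map_zsmul, Finset.smul_sum, smul_smul]
  rw [Finset.sum_comm]
  refine Fintype.sum_congr _ _ fun i => Fintype.sum_congr _ _ fun j => ?_
  congr 1
  ring

/-- The cone operator, which adds the entry `y` in front. -/
noncomputable def cone (y : Y) {k : ℕ} : TupleChains Y k →+ TupleChains Y (k + 1) :=
  freeLift fun v => tuple (Fin.cons y v : Fin (k + 1) → Y)

lemma cone_tuple (y : Y) {k : ℕ} (v : Fin k → Y) :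
    cone y (tuple v) = tuple (Fin.cons y v : Fin (k + 1) → Y) := freeLift_single _ _

lemma face_zero_cone (y : Y) {k : ℕ} (x : TupleChains Y k) : face 0 (cone y x) = x := by
  refine (isFreeBasis_single _).hom_ext (F := (face 0).comp (cone y))
    (F' := AddMonoidHom.id _) (fun v => ?_) x
  change face 0 (cone y (tuple v)) = tuple v
  rw [cone_tuple, face_tuple]
  congr 1

lemma face_succ_cone (y : Y) {k : ℕ} (i : Fin (k + 1)) (x : TupleChains Y (k + 1)) :
    face i.succ (cone y x) = cone y (face i x) := by
  refine (isFreeBasis_single _).hom_ext (F := (face i.succ).comp (cone y))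
    (F' := (cone y).comp (face i)) (fun v => ?_) x
  change face i.succ (cone y (tuple v)) = cone y (face i (tuple v))
  rw [cone_tuple, face_tuple, face_tuple, cone_tuple]
  congr 1
  funext j
  refine Fin.cases ?_ (fun j => ?_) j
  · rw [Fin.succ_succAbove_zero, Fin.cons_zero, Fin.cons_zero]
  · rw [Fin.succ_succAbove_succ, Fin.cons_succ, Fin.cons_succ]

/-- Tuples are indexed by length, so `boundary 0` is the augmentation. There is no correction term
at this end. -/
lemma boundary_cone_zero (y : Y) (x : TupleChains Y 0) : boundary 0 (cone y x) = x := by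
  simp [boundary_apply, face_zero_cone]

lemma boundary_cone_succ (y : Y) {k : ℕ} (x : TupleChains Y (k + 1)) :
    boundary (k + 1) (cone y x) = x - cone y (boundary k x) := by
  rw [boundary_apply, Fin.sum_univ_succ, boundary_apply, map_sum]
  simp only [Fin.val_zero, pow_zero, one_smul, face_zero_cone, Fin.val_succ, pow_succ, mul_neg,
    mul_one, neg_smul, face_succ_cone, Finset.sum_neg_distrib, map_zsmul, sub_eq_add_neg]

/-- The map induced by a map of vertices. -/
noncomputable def map (φ : Y → Y') {k : ℕ} : TupleChains Y k →+ TupleChains Y' k :=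
  freeLift fun v => tuple (φ ∘ v)

lemma map_tuple (φ : Y → Y') {k : ℕ} (v : Fin k → Y) : map φ (tuple v) = tuple (φ ∘ v) :=
  freeLift_single _ _

lemma map_cone (φ : Y → Y') (y : Y) {k : ℕ} (x : TupleChains Y k) :
    map φ (cone y x) = cone (φ y) (map φ x) := by
  refine (isFreeBasis_single _).hom_ext (F := (map φ).comp (cone y))
    (F' := (cone (φ y)).comp (map φ)) (fun v => ?_) x
  change map φ (cone y (tuple v)) = cone (φ y) (map φ (tuple v))
  rw [cone_tuple, map_tuple, map_tuple, cone_tuple]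
  congr 1
  funext j
  exact Fin.cases rfl (fun _ => rfl) j

lemma map_boundary (φ : Y → Y') {k : ℕ} (x : TupleChains Y (k + 1)) :
    map φ (boundary k x) = boundary k (map φ x) := by
  refine (isFreeBasis_single _).hom_ext (F := (map φ).comp (boundary k))
    (F' := (boundary k).comp (map φ)) (fun v => ?_) x
  change map φ (boundary k (tuple v)) = boundary k (map φ (tuple v))
  simp only [boundary_apply, map_sum, map_zsmul, face_tuple, map_tuple]
  rfl

variable (b : ∀ k, (Fin (k + 1) → Y) → Y) (b' : ∀ k, (Fin (k + 1) → Y') → Y')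

/-- The subdivision operator with centers `b`. -/
noncomputable def sd : ∀ k, TupleChains Y k →+ TupleChains Y k
  | 0 => AddMonoidHom.id _
  | k + 1 => freeLift fun v => cone (b k v) (sd k (boundary k (tuple v)))

lemma sd_zero (x : TupleChains Y 0) : sd b 0 x = x := rfl

lemma sd_tuple {k : ℕ} (v : Fin (k + 1) → Y) :
    sd b (k + 1) (tuple v) = cone (b k v) (sd b k (boundary k (tuple v))) := freeLift_single _ _

/-- The homotopy from the subdivision operator to the identity. -/
noncomputable def sdHomotopy : ∀ k, TupleChains Y k →+ TupleChains Y (k + 1)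
  | 0 => 0
  | k + 1 => freeLift fun v => cone (b k v) (tuple v - sdHomotopy k (boundary k (tuple v)))

lemma sdHomotopy_zero (x : TupleChains Y 0) : sdHomotopy b 0 x = 0 := rfl

lemma sdHomotopy_tuple {k : ℕ} (v : Fin (k + 1) → Y) :
    sdHomotopy b (k + 1) (tuple v) =
      cone (b k v) (tuple v - sdHomotopy b k (boundary k (tuple v))) := freeLift_single _ _

/-- By the cone formula, `d (b · sd dv) = sd dv - b · (d sd dv)`. The last term is `b · (sd ddv) =
0` by the same statement one length lower. -/
lemma boundary_sd {k : ℕ} (x : TupleChains Y (k + 1)) :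
    boundary k (sd b (k + 1) x) = sd b k (boundary k x) := by
  refine (isFreeBasis_single _).hom_ext (F := (boundary k).comp (sd b (k + 1)))
    (F' := (sd b k).comp (boundary k)) (fun v => ?_) x
  change boundary k (sd b (k + 1) (tuple v)) = sd b k (boundary k (tuple v))
  rw [sd_tuple]
  cases k with
  | zero => rw [boundary_cone_zero]
  | succ k => rw [boundary_cone_succ, boundary_sd, boundary_boundary, map_zero, map_zero, sub_zero]

/-- By the cone formula it suffices that `d (v - T dv) = sd dv`, where `T` is the homotopy. This is
the same statement one length lower, applied to `dv`. -/
lemma boundary_sdHomotopy {k : ℕ} (x : TupleChains Y (k + 1)) :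
    boundary (k + 1) (sdHomotopy b (k + 1) x) =
      x - sd b (k + 1) x - sdHomotopy b k (boundary k x) := by
  refine (isFreeBasis_single _).hom_ext (F := (boundary (k + 1)).comp (sdHomotopy b (k + 1)))
    (F' := AddMonoidHom.id _ - sd b (k + 1) - (sdHomotopy b k).comp (boundary k))
    (fun v => ?_) x
  change boundary (k + 1) (sdHomotopy b (k + 1) (tuple v)) =
    tuple v - sd b (k + 1) (tuple v) - sdHomotopy b k (boundary k (tuple v))
  rw [sdHomotopy_tuple, boundary_cone_succ, sd_tuple, map_sub]
  have h : boundary k (tuple v) - boundary k (sdHomotopy b k (boundary k (tuple v))) =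
      sd b k (boundary k (tuple v)) := by
    cases k with
    | zero => rw [sdHomotopy_zero, map_zero, sub_zero, sd_zero]
    | succ k =>
      rw [boundary_sdHomotopy, boundary_boundary, map_zero]
      abel
  rw [h]
  abel

variable {b b'} {φ : Y → Y'}

/-- Subdivision is built from boundaries, centers and cones, so it commutes with any map of vertices
that respects the centers. Affine maps and barycenters are the intended case. -/
lemma map_sd (hφ : ∀ k v, φ (b k v) = b' k (φ ∘ v)) {k : ℕ} (x : TupleChains Y k) :
    map φ (sd b k x) = sd b' k (map φ x) := by
  induction k with
  | zero => rfl
  | succ k ih =>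
    refine (isFreeBasis_single _).hom_ext (F := (map φ).comp (sd b (k + 1)))
      (F' := (sd b' (k + 1)).comp (map φ)) (fun v => ?_) x
    change map φ (sd b (k + 1) (tuple v)) = sd b' (k + 1) (map φ (tuple v))
    rw [sd_tuple, map_tuple, sd_tuple, map_cone, ih, hφ, map_boundary, map_tuple]

lemma map_sdHomotopy (hφ : ∀ k v, φ (b k v) = b' k (φ ∘ v)) {k : ℕ} (x : TupleChains Y k) :
    map φ (sdHomotopy b k x) = sdHomotopy b' k (map φ x) := by
  induction k with
  | zero => rw [sdHomotopy_zero, sdHomotopy_zero, map_zero]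
  | succ k ih =>
    refine (isFreeBasis_single _).hom_ext (F := (map φ).comp (sdHomotopy b (k + 1)))
      (F' := (sdHomotopy b' (k + 1)).comp (map φ)) (fun v => ?_) x
    change map φ (sdHomotopy b (k + 1) (tuple v)) = sdHomotopy b' (k + 1) (map φ (tuple v))
    rw [sdHomotopy_tuple, map_tuple, sdHomotopy_tuple, map_cone, map_sub, ih, hφ, map_boundary,
      map_tuple]

section Fine

variable [PseudoMetricSpace Y]

/-- The chains on tuples with pairwise distances at most `r`. -/
noncomputable def fineChains (Y : Type*) [PseudoMetricSpace Y] (r : ℝ) (k : ℕ) :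
    AddSubgroup (TupleChains Y k) :=
  AddSubgroup.closure (tuple '' {w | ∀ i j, dist (w i) (w j) ≤ r})

/-- The chains on tuples with pairwise distances at most `r` and with entries in all balls which
contain the entries of `v`. -/
noncomputable def fineChainsIn (r : ℝ) {l : ℕ} (v : Fin l → Y) (k : ℕ) :
    AddSubgroup (TupleChains Y k) :=
  AddSubgroup.closure (tuple '' {w | (∀ i j, dist (w i) (w j) ≤ r) ∧
    ∀ p ρ, (∀ i, dist (v i) p ≤ ρ) → ∀ i, dist (w i) p ≤ ρ})

lemma fineChainsIn_le (r : ℝ) {l : ℕ} (v : Fin l → Y) (k : ℕ) :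
    fineChainsIn r v k ≤ fineChains Y r k :=
  AddSubgroup.closure_mono (image_mono fun _ hw => hw.1)

lemma fineChainsIn_comp_le (r : ℝ) {l l' : ℕ} (v : Fin l → Y) (f : Fin l' → Fin l) (k : ℕ) :
    fineChainsIn r (fun i => v (f i)) k ≤ fineChainsIn r v k :=
  AddSubgroup.closure_mono (image_mono fun _ hw =>
    ⟨hw.1, fun p ρ h => hw.2 p ρ fun i => h (f i)⟩)

/-- The second condition in `fineChainsIn` acts as a metric convex hull. Applied to the ball of
radius `r` about `y`, it bounds the distance of `y` to every old entry. -/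
lemma cone_mem_fineChainsIn {r : ℝ} (hr : 0 ≤ r) {l : ℕ} {v : Fin l → Y} {y : Y}
    (hy : ∀ i, dist (v i) y ≤ r) (hy' : ∀ p ρ, (∀ i, dist (v i) p ≤ ρ) → dist y p ≤ ρ) {k : ℕ}
    {x : TupleChains Y k} (hx : x ∈ fineChainsIn r v k) : cone y x ∈ fineChainsIn r v (k + 1) := by
  refine map_mem_of_closure rfl (cone y) _ ?_ x hx
  rintro _ ⟨w, ⟨hw, hw'⟩, rfl⟩
  rw [cone_tuple]
  refine AddSubgroup.subset_closure ⟨_, ⟨fun i j => ?_, fun p ρ h i => ?_⟩, rfl⟩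
  · refine Fin.cases ?_ (fun i => ?_) i <;> refine Fin.cases ?_ (fun j => ?_) j
    · simpa using hr
    · rw [Fin.cons_zero, Fin.cons_succ, dist_comm]
      exact hw' _ _ hy j
    · rw [Fin.cons_zero, Fin.cons_succ]
      exact hw' _ _ hy i
    · rw [Fin.cons_succ, Fin.cons_succ]
      exact hw i j
  · refine Fin.cases ?_ (fun i => ?_) i
    · exact hy' p ρ h
    · exact hw' p ρ h i

/-- The entries of the subdivided boundary are not entries of `v`, but they lie in every ball that
contains `v`, in particular in the ball of radius `c * r` about the center of `v`. Tracking this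
hull condition along with the distances makes the induction close. -/
lemma sd_tuple_mem_fineChainsIn {n : ℕ} {c r : ℝ} (hc : 0 ≤ c) (hr : 0 ≤ r)
    (hb : ∀ k v p ρ, (∀ i, dist (v i) p ≤ ρ) → dist (b k v) p ≤ ρ)
    (hbc : ∀ k < n, ∀ v : Fin (k + 1) → Y, (∀ i j, dist (v i) (v j) ≤ r) →
      ∀ i, dist (v i) (b k v) ≤ c * r)
    {k : ℕ} (hk : k ≤ n) (v : Fin k → Y) (hv : ∀ i j, dist (v i) (v j) ≤ r) :
    sd b k (tuple v) ∈ fineChainsIn (c * r) v k := by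
  induction k with
  | zero => exact AddSubgroup.subset_closure ⟨v, ⟨fun i => i.elim0, fun _ _ _ i => i.elim0⟩, rfl⟩
  | succ k ih =>
    rw [sd_tuple]
    refine cone_mem_fineChainsIn (mul_nonneg hc hr) (hbc k hk v hv) (hb k v) ?_
    rw [boundary_apply, map_sum]
    refine sum_mem fun i _ => ?_
    rw [map_zsmul, face_tuple]
    exact zsmul_mem (fineChainsIn_comp_le _ v i.succAbove k
      (ih (by omega) _ fun _ _ => hv _ _)) _

lemma sd_mem_fineChains {n : ℕ} {c r : ℝ} (hc : 0 ≤ c) (hr : 0 ≤ r)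
    (hb : ∀ k v p ρ, (∀ i, dist (v i) p ≤ ρ) → dist (b k v) p ≤ ρ)
    (hbc : ∀ k < n, ∀ v : Fin (k + 1) → Y, (∀ i j, dist (v i) (v j) ≤ r) →
      ∀ i, dist (v i) (b k v) ≤ c * r)
    {x : TupleChains Y n} (hx : x ∈ fineChains Y r n) : sd b n x ∈ fineChains Y (c * r) n := by
  refine map_mem_of_closure rfl (sd b n) _ ?_ x hx
  rintro _ ⟨v, hv, rfl⟩
  exact fineChainsIn_le _ _ _ (sd_tuple_mem_fineChainsIn hc hr hb hbc le_rfl v hv)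

end Fine

end TupleChains

end Tuples

/-! ### Affine simplices -/

noncomputable instance (n : ℕ) : MetricSpace (Interval.I.Simp n) :=
  inferInstanceAs (MetricSpace (stdSimplex ℝ (Fin (n + 1))))

instance (n : ℕ) : CompactSpace (Interval.I.Simp n) :=
  inferInstanceAs (CompactSpace (stdSimplex ℝ (Fin (n + 1))))

namespace Interval

variable {k m n : ℕ}

/-- The barycentric coordinates of a point of the standard simplex. -/
def coord (x : I.Simp n) : Fin (n + 1) → ℝ :=
  Subtype.val (p := fun x => x ∈ stdSimplex ℝ (Fin (n + 1))) x

lemma coord_injective : Function.Injective (coord (n := n)) := Subtype.val_injective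

lemma isEmbedding_coord : Topology.IsEmbedding (coord (n := n)) :=
  Topology.IsEmbedding.subtypeVal

lemma coord_nonneg (x : I.Simp n) (i : Fin (n + 1)) : 0 ≤ coord x i := x.2.1 i

lemma sum_coord (x : I.Simp n) : ∑ i, coord x i = 1 := x.2.2

lemma dist_simp_le_iff {x y : I.Simp n} {r : ℝ} (hr : 0 ≤ r) :
    dist x y ≤ r ↔ ∀ i, |coord x i - coord y i| ≤ r :=
  dist_pi_le_iff hr

lemma nhd_simp (x : I.Simp n) : nhd x = nhds x :=
  nhd_ofTopology (Y := stdSimplex ℝ (Fin (n + 1))) x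

/-- The affine combination of the points `v j` with the coefficients `coord x j`. -/
def affineComb (v : Fin (k + 1) → I.Simp n) (x : I.Simp k) : I.Simp n :=
  (⟨fun i => ∑ j, coord x j * coord (v j) i,
    fun i => Finset.sum_nonneg fun j _ => mul_nonneg (coord_nonneg x j) (coord_nonneg (v j) i), by
    rw [Finset.sum_comm]
    simp only [← Finset.mul_sum, sum_coord, mul_one]⟩ : stdSimplex ℝ (Fin (n + 1)))

lemma coord_affineComb (v : Fin (k + 1) → I.Simp n) (x : I.Simp k) (i : Fin (n + 1)) :
    coord (affineComb v x) i = ∑ j, coord x j * coord (v j) i := rfl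

lemma affineComb_affineComb (w : Fin (m + 1) → I.Simp n) (v : Fin (k + 1) → I.Simp m)
    (x : I.Simp k) : affineComb w (affineComb v x) = affineComb (affineComb w ∘ v) x := by
  refine coord_injective (funext fun i => ?_)
  simp only [coord_affineComb, Function.comp_apply, Finset.sum_mul, Finset.mul_sum]
  rw [Finset.sum_comm]
  simp only [mul_assoc]

lemma continuous_affineComb (v : Fin (k + 1) → I.Simp n) : Continuous (affineComb v) := by
  have h := isEmbedding_coord (n := k).continuous
  rw [isEmbedding_coord.continuous_iff]
  refine continuous_pi fun i => ?_
  change Continuous fun x : I.Simp k => ∑ j, coord x j * coord (v j) i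
  refine continuous_finsetSum _ fun j _ => ?_
  exact ((continuous_apply j).comp h).mul continuous_const

/-- The affine simplex with vertices `v`. -/
def affineMap (v : Fin (k + 1) → I.Simp n) : ContMap (I.Simp k) (I.Simp n) where
  toFun := affineComb v
  cont := by
    rw [isCont_iff_tendsto]
    intro x
    rw [nhd_simp, nhd_simp]
    exact (continuous_affineComb v).tendsto x

/-- The vertices of the standard simplex. -/
def vertex (i : Fin (n + 1)) : I.Simp n :=
  (stdSimplex.vertex (S := ℝ) i : stdSimplex ℝ (Fin (n + 1)))

lemma coord_vertex (i j : Fin (n + 1)) : coord (vertex i) j = if j = i then 1 else 0 :=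
  Pi.single_apply i (1 : ℝ) j

lemma affineComb_vertex (v : Fin (k + 1) → I.Simp n) (i : Fin (k + 1)) :
    affineComb v (vertex i) = v i := by
  refine coord_injective (funext fun j => ?_)
  simp [coord_affineComb, coord_vertex]

lemma affineComb_vertex_comp (v : Fin (k + 1) → I.Simp n) : affineComb v ∘ vertex = v :=
  funext (affineComb_vertex v)

/-- Through this identity the faces of an affine simplex are obtained by omitting vertices. -/
lemma simpMap_eq_affineMap (f : Fin (m + 1) →o Fin (n + 1)) :
    I.simpMap f = affineMap fun i => vertex (f i) := by
  apply ContMap.ext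
  funext x
  refine coord_injective (funext fun j => ?_)
  change _ = coord (affineComb _ x) j
  rw [coord_affineComb]
  refine (FunOnFinite.linearMap_apply_apply ℝ ℝ f (coord x) j).trans ?_
  simp only [coord_vertex, mul_ite, mul_one, mul_zero, Finset.sum_filter, eq_comm]

lemma affineMap_vertex_comp {X : Type*} [ClosureSpace X] (σ : ContMap (I.Simp n) X) :
    σ.comp (affineMap vertex) = σ := by
  apply ContMap.ext
  funext x
  change σ.toFun (affineComb vertex x) = σ.toFun x
  congr 1
  refine coord_injective (funext fun j => ?_)
  simp [coord_affineComb, coord_vertex]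

lemma affineMap_comp_affineMap (w : Fin (m + 1) → I.Simp n) (v : Fin (k + 1) → I.Simp m) :
    (affineMap w).comp (affineMap v) = affineMap (affineComb w ∘ v) :=
  ContMap.ext (funext (affineComb_affineComb w v))

/-- Balls are convex: the difference from `p` is the weighted average of the differences of the
vertices from `p`. -/
lemma dist_affineComb_le {v : Fin (k + 1) → I.Simp n} {p : I.Simp n} {r : ℝ}
    (h : ∀ i, dist (v i) p ≤ r) (x : I.Simp k) : dist (affineComb v x) p ≤ r := by
  have hr : 0 ≤ r := dist_nonneg.trans (h 0)
  refine (dist_simp_le_iff hr).2 fun i => ?_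
  have hp : coord (affineComb v x) i - coord p i =
      ∑ j, coord x j * (coord (v j) i - coord p i) := by
    simp only [coord_affineComb, mul_sub, Finset.sum_sub_distrib, ← Finset.sum_mul, sum_coord,
      one_mul]
  rw [hp]
  calc |∑ j, coord x j * (coord (v j) i - coord p i)|
      ≤ ∑ j, coord x j * r := (Finset.abs_sum_le_sum_abs _ _).trans (Finset.sum_le_sum fun j _ => by
        rw [abs_mul, abs_of_nonneg (coord_nonneg x j)]
        exact mul_le_mul_of_nonneg_left ((dist_simp_le_iff hr).1 (h j) i) (coord_nonneg x j))
    _ = r := by rw [← Finset.sum_mul, sum_coord, one_mul]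

/-- The barycenter of the standard simplex. -/
noncomputable def center (k : ℕ) : I.Simp k :=
  (⟨fun _ => ((k : ℝ) + 1)⁻¹, fun _ => by positivity, by
    simp only [Finset.sum_const, Finset.card_univ, Fintype.card_fin, nsmul_eq_mul, Nat.cast_add,
      Nat.cast_one]
    exact mul_inv_cancel₀ (by positivity)⟩ : stdSimplex ℝ (Fin (k + 1)))

lemma coord_center (i : Fin (k + 1)) : coord (center k) i = ((k : ℝ) + 1)⁻¹ := rfl

/-- The barycenter of a family of points. -/
noncomputable def barycenter (k : ℕ) (v : Fin (k + 1) → I.Simp n) : I.Simp n :=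
  affineComb v (center k)

lemma affineComb_barycenter (w : Fin (m + 1) → I.Simp n) (k : ℕ) (v : Fin (k + 1) → I.Simp m) :
    affineComb w (barycenter k v) = barycenter k (affineComb w ∘ v) :=
  affineComb_affineComb w v _

/-- In the average of the `k + 1` differences `v j - v i` the one with `j = i` is zero, which leaves
`k` terms of size at most `r`. -/
lemma dist_barycenter_le {v : Fin (k + 1) → I.Simp n} {r : ℝ}
    (h : ∀ i j, dist (v i) (v j) ≤ r) (i : Fin (k + 1)) :
    dist (v i) (barycenter k v) ≤ k / (k + 1) * r := by
  have hr : 0 ≤ r := dist_nonneg.trans (h 0 0)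
  rw [dist_comm]
  refine (dist_simp_le_iff (by positivity)).2 fun l => ?_
  have hp : coord (barycenter k v) l - coord (v i) l =
      ((k : ℝ) + 1)⁻¹ * ∑ j ∈ Finset.univ.erase i, (coord (v j) l - coord (v i) l) := by
    rw [Finset.sum_erase _ (sub_self _), barycenter, coord_affineComb, Finset.mul_sum]
    simp only [coord_center, mul_sub, Finset.sum_sub_distrib, Finset.sum_const, Finset.card_univ,
      Fintype.card_fin, nsmul_eq_mul, Nat.cast_add, Nat.cast_one, ← mul_assoc]
    rw [mul_inv_cancel₀ (by positivity : (k : ℝ) + 1 ≠ 0), one_mul]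
  have hs : |∑ j ∈ Finset.univ.erase i, (coord (v j) l - coord (v i) l)| ≤ k * r := by
    refine (Finset.abs_sum_le_sum_abs _ _).trans
      ((Finset.sum_le_card_nsmul _ _ r fun j _ => (dist_simp_le_iff hr).1 (h j i) l).trans ?_)
    rw [Finset.card_erase_of_mem (Finset.mem_univ i), Finset.card_univ, Fintype.card_fin,
      Nat.add_sub_cancel, nsmul_eq_mul]
  rw [hp, abs_mul, abs_of_nonneg (by positivity), div_mul_eq_mul_div, div_eq_inv_mul]
  exact mul_le_mul_of_nonneg_left hs (by positivity)

end Interval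

/-! ### Subdivision of simplices -/

section Simplices

open TupleChains CechClosure.Interval

variable {X : Type u} [ClosureSpace X] {ι : Type v} {U : ι → Set X}

lemma isFreeBasis_simplexChain (J : Interval) (n : ℕ) :
    IsFreeBasis (simplexChain : ContMap (J.Simp n) X → _) :=
  ⟨AddEquiv.refl _, fun _ => rfl⟩

lemma smallSimplicialChains_carrier (J : Interval) (n : ℕ) :
    (smallSimplicialChains J U).carrier n = AddSubgroup.closure
      (simplexChain '' {σ : ContMap (J.Simp n) X | IsSmall U σ.toFun}) := by
  change AddSubgroup.closure _ = _
  congr 1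
  ext x
  exact ⟨fun ⟨σ, h, hx⟩ => ⟨σ, h, hx.symm⟩, fun ⟨σ, h, hx⟩ => ⟨σ, h, hx.symm⟩⟩

lemma IsSmall.simplexChain_mem {J : Interval} {n : ℕ} {σ : ContMap (J.Simp n) X}
    (h : IsSmall U σ.toFun) : simplexChain σ ∈ (smallSimplicialChains J U).carrier n := by
  rw [smallSimplicialChains_carrier]
  exact AddSubgroup.subset_closure ⟨σ, h, rfl⟩

/-- The chain of `X` which a singular simplex assigns to a chain of affine simplices. -/
noncomputable def affineChain {n : ℕ} (σ : ContMap (I.Simp n) X) (k : ℕ) :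
    TupleChains (I.Simp n) (k + 1) →+ (simplicialChains I X).X k :=
  freeLift fun v => simplexChain (σ.comp (affineMap v))

lemma affineChain_tuple {n k : ℕ} (σ : ContMap (I.Simp n) X) (v : Fin (k + 1) → I.Simp n) :
    affineChain σ k (tuple v) = simplexChain (σ.comp (affineMap v)) := freeLift_single _ _

lemma affineChain_vertex {n : ℕ} (σ : ContMap (I.Simp n) X) :
    affineChain σ n (tuple vertex) = simplexChain σ := by
  rw [affineChain_tuple, affineMap_vertex_comp]

lemma simplexFace_comp_affineMap {n k : ℕ} (σ : ContMap (I.Simp n) X)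
    (v : Fin (k + 2) → I.Simp n) (i : Fin (k + 2)) :
    simplexFace i (σ.comp (affineMap v)) = σ.comp (affineMap fun j => v (i.succAbove j)) := by
  change σ.comp ((affineMap v).comp (I.simpMap _)) = _
  rw [simpMap_eq_affineMap, affineMap_comp_affineMap]
  congr 2
  funext j
  exact affineComb_vertex v _

lemma d_affineChain {n k : ℕ} (σ : ContMap (I.Simp n) X) (x : TupleChains (I.Simp n) (k + 2)) :
    ((simplicialChains I X).d (k + 1) k).hom (affineChain σ (k + 1) x) =
      affineChain σ k (boundary (k + 1) x) := by
  refine (isFreeBasis_single _).hom_ext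
    (F := ((simplicialChains I X).d (k + 1) k).hom.comp (affineChain σ (k + 1)))
    (F' := (affineChain σ k).comp (boundary (k + 1))) (fun v => ?_) x
  change ((simplicialChains I X).d (k + 1) k).hom (affineChain σ (k + 1) (tuple v)) =
      affineChain σ k (boundary (k + 1) (tuple v))
  rw [affineChain_tuple, simplicialChains_d, boundary_apply, map_sum]
  refine Fintype.sum_congr _ _ fun i => ?_
  rw [map_zsmul, face_tuple, affineChain_tuple, simplexFace_comp_affineMap]

lemma affineChain_comp {n k : ℕ} (σ : ContMap (I.Simp n) X) {m : ℕ}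
    (v : Fin (m + 1) → I.Simp n) (x : TupleChains (I.Simp m) (k + 1)) :
    affineChain (σ.comp (affineMap v)) k x =
      affineChain σ k (TupleChains.map (affineComb v) x) := by
  refine (isFreeBasis_single _).hom_ext (F := affineChain (σ.comp (affineMap v)) k)
    (F' := (affineChain σ k).comp (TupleChains.map (affineComb v))) (fun w => ?_) x
  change affineChain (σ.comp (affineMap v)) k (tuple w) =
    affineChain σ k (TupleChains.map (affineComb v) (tuple w))
  rw [affineChain_tuple, map_tuple, affineChain_tuple, ← affineMap_comp_affineMap]
  rfl

lemma IsSmall.affineChain_mem {n k : ℕ} {σ : ContMap (I.Simp n) X} (h : IsSmall U σ.toFun)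
    (x : TupleChains (I.Simp n) (k + 1)) :
    affineChain σ k x ∈ (smallSimplicialChains I U).carrier k := by
  refine (isFreeBasis_single _).mem_of_forall
    (((smallSimplicialChains I U).carrier k).comap (affineChain σ k)) (fun v => ?_) x
  change affineChain σ k (tuple v) ∈ (smallSimplicialChains I U).carrier k
  rw [affineChain_tuple]
  exact IsSmall.simplexChain_mem (h.comp _)

/-- An affine simplex whose vertices are within `δ` of the vertex `w 0` lies in the ball of radius
`δ` about it, by convexity. -/
lemma IsFine.affineChain_mem {n k : ℕ} {σ : ContMap (I.Simp n) X} {δ : ℝ}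
    (h : IsFine U δ σ.toFun) {x : TupleChains (I.Simp n) (k + 1)}
    (hx : x ∈ fineChains (I.Simp n) δ (k + 1)) :
    affineChain σ k x ∈ (smallSimplicialChains I U).carrier k := by
  refine map_mem_of_closure rfl (affineChain σ k) _ ?_ x hx
  rintro _ ⟨w, hw, rfl⟩
  rw [affineChain_tuple]
  obtain ⟨j, hj⟩ := h (w 0)
  refine IsSmall.simplexChain_mem ⟨j, ?_⟩
  rintro _ ⟨y, rfl⟩
  exact hj _ (dist_affineComb_le (fun i => hw i 0) y)

lemma iterate_sd_mem_fineChains {n : ℕ} {r : ℝ} (hr : 0 ≤ r)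
    {x : TupleChains (I.Simp n) (n + 1)} (hx : x ∈ fineChains (I.Simp n) r (n + 1)) (m : ℕ) :
    (sd barycenter (n + 1))^[m] x ∈ fineChains (I.Simp n) ((n / (n + 1) : ℝ) ^ m * r) (n + 1) := by
  induction m with
  | zero => simpa using hx
  | succ m ih =>
    rw [Function.iterate_succ_apply', pow_succ', mul_assoc]
    have hr' : 0 ≤ (n / (n + 1) : ℝ) ^ m * r := by positivity
    refine sd_mem_fineChains (by positivity) hr' (fun k v p ρ h => dist_affineComb_le h _)
      (fun k hk v hv i => (dist_barycenter_le hv i).trans ?_) ih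
    -- The ratio `k / (k + 1)` increases with `k`, so the top-dimensional value serves for all
    -- faces.
    refine mul_le_mul_of_nonneg_right ?_ hr'
    have hkn : (k : ℝ) ≤ n := by exact_mod_cast Nat.lt_succ_iff.1 hk
    rw [div_le_div_iff₀ (by positivity) (by positivity)]
    linarith

lemma nonempty_subdivision_smallSimplicialChains (hU : IsInteriorCover U) :
    Nonempty (Subdivision (smallSimplicialChains I U)) := by
  choose S hS using fun n => (isFreeBasis_simplexChain (X := X) I n).exists_lift
    fun σ => affineChain σ n (sd barycenter (n + 1) (tuple vertex))
  choose T hT using fun n => (isFreeBasis_simplexChain (X := X) I n).exists_lift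
    fun σ => affineChain σ (n + 1) (sdHomotopy barycenter (n + 1) (tuple vertex))
  -- `S` is defined by subdividing the universal simplex. Naturality under affine maps then computes
  -- `S` on every affine chain, so iterating `S` on `σ` amounts to iterating `sd` on one tuple.
  have S_affine : ∀ {n k : ℕ} (σ : ContMap (I.Simp n) X) (x : TupleChains (I.Simp n) (k + 1)),
      S k (affineChain σ k x) = affineChain σ k (sd barycenter (k + 1) x) := by
    intro n k σ x
    refine (isFreeBasis_single _).hom_ext (F := (S k).comp (affineChain σ k))
      (F' := (affineChain σ k).comp (sd barycenter (k + 1))) (fun v => ?_) x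
    change S k (affineChain σ k (tuple v)) = affineChain σ k (sd barycenter (k + 1) (tuple v))
    rw [affineChain_tuple, hS, affineChain_comp, map_sd (affineComb_barycenter v), map_tuple,
      affineComb_vertex_comp]
  have T_affine : ∀ {n k : ℕ} (σ : ContMap (I.Simp n) X) (x : TupleChains (I.Simp n) (k + 1)),
      T k (affineChain σ k x) = affineChain σ (k + 1) (sdHomotopy barycenter (k + 1) x) := by
    intro n k σ x
    refine (isFreeBasis_single _).hom_ext (F := (T k).comp (affineChain σ k))
      (F' := (affineChain σ (k + 1)).comp (sdHomotopy barycenter (k + 1))) (fun v => ?_) x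
    change T k (affineChain σ k (tuple v)) =
      affineChain σ (k + 1) (sdHomotopy barycenter (k + 1) (tuple v))
    rw [affineChain_tuple, hT, affineChain_comp, map_sdHomotopy (affineComb_barycenter v),
      map_tuple, affineComb_vertex_comp]
  have S_mem : ∀ n, ∀ x ∈ (smallSimplicialChains I U).carrier n,
      S n x ∈ (smallSimplicialChains I U).carrier n := by
    refine fun n => map_mem_of_closure (smallSimplicialChains_carrier I n) _ _ ?_
    rintro _ ⟨σ, hσ, rfl⟩
    rw [hS]
    exact IsSmall.affineChain_mem hσ _
  have T_mem : ∀ n, ∀ x ∈ (smallSimplicialChains I U).carrier n,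
      T n x ∈ (smallSimplicialChains I U).carrier (n + 1) := by
    refine fun n => map_mem_of_closure (smallSimplicialChains_carrier I n) _ _ ?_
    rintro _ ⟨σ, hσ, rfl⟩
    rw [hT]
    exact IsSmall.affineChain_mem hσ _
  -- Unlike in the cubical case, the homotopy relation holds exactly. Writing `σ` as the affine
  -- chain on the vertex tuple reduces it to `boundary_sdHomotopy`.
  have mem_zero : ∀ x : (simplicialChains I X).X 0,
      ((simplicialChains I X).d 1 0).hom (T 0 x) = x - S 0 x := by
    refine (isFreeBasis_simplexChain I 0).hom_ext
      (F := ((simplicialChains I X).d 1 0).hom.comp (T 0)) (F' := AddMonoidHom.id _ - S 0)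
      fun σ => ?_
    change ((simplicialChains I X).d 1 0).hom (T 0 (simplexChain σ)) =
      simplexChain σ - S 0 (simplexChain σ)
    rw [← affineChain_vertex, T_affine, S_affine, d_affineChain, boundary_sdHomotopy,
      sdHomotopy_zero, sub_zero, map_sub]
  have mem_succ : ∀ n (x : (simplicialChains I X).X (n + 1)),
      ((simplicialChains I X).d (n + 2) (n + 1)).hom (T (n + 1) x) +
        T n (((simplicialChains I X).d (n + 1) n).hom x) = x - S (n + 1) x := by
    intro n
    refine (isFreeBasis_simplexChain I (n + 1)).hom_ext
      (F := ((simplicialChains I X).d (n + 2) (n + 1)).hom.comp (T (n + 1)) +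
        (T n).comp ((simplicialChains I X).d (n + 1) n).hom)
      (F' := AddMonoidHom.id _ - S (n + 1)) fun σ => ?_
    change ((simplicialChains I X).d (n + 2) (n + 1)).hom (T (n + 1) (simplexChain σ)) +
        T n (((simplicialChains I X).d (n + 1) n).hom (simplexChain σ)) =
      simplexChain σ - S (n + 1) (simplexChain σ)
    rw [← affineChain_vertex, d_affineChain, T_affine, T_affine, S_affine, d_affineChain,
      boundary_sdHomotopy, map_sub, map_sub, sub_add_cancel]
  refine ⟨⟨S, T, S_mem, T_mem, fun x => ?_, fun n x => ?_, fun n => ?_⟩⟩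
  · rw [mem_zero, sub_self]
    exact zero_mem _
  · rw [mem_succ, sub_self]
    exact zero_mem _
  · refine (isFreeBasis_simplexChain I n).exists_iterate_mem (S_mem n) fun σ => ?_
    obtain ⟨δ, hδ, h⟩ := exists_isFine hU (f := σ.toFun) fun z => by
      have := isCont_iff_tendsto.1 σ.cont z
      rwa [nhd_simp] at this
    -- In the sup metric the vertices have pairwise distances at most `1`, which is the starting
    -- radius.
    have hv : tuple vertex ∈ fineChains (I.Simp n) 1 (n + 1) := by
      refine AddSubgroup.subset_closure ⟨_, fun i j => (dist_simp_le_iff zero_le_one).2 fun l => ?_,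
        rfl⟩
      rw [coord_vertex, coord_vertex]
      split_ifs <;> simp
    obtain ⟨m, hm⟩ := exists_pow_lt_of_lt_one hδ
      ((div_lt_one (by positivity)).2 (lt_add_one (n : ℝ)))
    refine ⟨m, ?_⟩
    have hit : (S n)^[m] (simplexChain σ) =
        affineChain σ n ((sd barycenter (n + 1))^[m] (tuple vertex)) := by
      rw [← affineChain_vertex]
      exact (Function.Semiconj.iterate_right (fun x => (S_affine σ x).symm) m _).symm
    rw [hit]
    refine (h.mono (δ' := (n / (n + 1) : ℝ) ^ m * 1) ?_).affineChain_mem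
      (iterate_sd_mem_fineChains zero_le_one hv m)
    rw [mul_one]
    exact hm.le

lemma nonempty_deformation_smallSimplicialChains (hU : IsInteriorCover U) :
    Nonempty (Deformation (smallSimplicialChains I U)) := by
  obtain ⟨s⟩ := nonempty_subdivision_smallSimplicialChains hU
  exact s.nonempty_deformation (isFreeBasis_simplexChain I) (smallSimplicialChains_carrier I)

end Simplices

/-! ### The discrete intervals -/

section Discrete

variable {X : Type u} [ClosureSpace X] {ι : Type v} {U : ι → Set X}

/-- The preimage of a neighborhood of `f z` is a neighborhood of `z`, hence everything. -/
lemma isSmall_of_nhd_eq_top (hU : IsInteriorCover U) {Z : Type*} [ClosureSpace Z] {z : Z}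
    (hz : nhd z = ⊤) {f : Z → X} (hf : IsCont f) : IsSmall U f := by
  obtain ⟨j, hj⟩ := exists_mem_nhd hU (f z)
  have h := isCont_iff_tendsto.1 hf z hj
  rw [hz, Filter.mem_map, Filter.mem_top] at h
  exact ⟨j, range_subset_iff.2 fun y => h.ge (mem_univ y)⟩

/-- Such a point lies in the closure of every nonempty set, so a neighborhood of it must have empty
complement. -/
lemma nhd_ofRel_eq_top {Y : Type*} {r : Y → Y → Prop} {hr : ∀ y, r y y} {y : Y}
    (h : ∀ x, r x y) : @nhd Y (ofRel r hr) y = ⊤ := by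
  ext V
  rw [Filter.mem_top, ← compl_empty_iff, eq_empty_iff_forall_notMem]
  change ¬ (∃ x ∈ Vᶜ, r x y) ↔ _
  simp only [h, and_true, not_exists]

lemma exists_nhd_simp_eq_top {J : Interval} (hJ : J = .Jone ∨ J = .Jplus) (n : ℕ) :
    ∃ x : J.Simp n, nhd x = ⊤ := by
  rcases hJ with rfl | rfl
  · exact ⟨(Fin.last n : Fin (n + 1)), nhd_ofRel_eq_top (hr := fun _ => trivial) fun _ => trivial⟩
  -- For `J_+` the choice matters: only the largest vertex lies in the closure of every vertex.
  · exact ⟨(Fin.last n : Fin (n + 1)), nhd_ofRel_eq_top (hr := fun _ => le_rfl) Fin.le_last⟩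

lemma exists_nhd_cube_eq_top {J : Interval} (hJ : J = .Jone ∨ J = .Jplus) (n : ℕ) :
    ∃ x : J.Cube n, nhd x = ⊤ := by
  have h : ∃ x : J.Pt, nhd x = ⊤ := by
    rcases hJ with rfl | rfl
    · exact ⟨(Fin.last 1 : Fin 2), nhd_ofRel_eq_top (hr := fun _ => trivial) fun _ => trivial⟩
    · exact ⟨(Fin.last 1 : Fin 2), nhd_ofRel_eq_top (hr := fun _ => le_rfl) Fin.le_last⟩
  obtain ⟨x, hx⟩ := h
  refine ⟨fun _ => x, ?_⟩
  rw [nhd_pi]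
  simp only [hx, Filter.pi, Filter.comap_top, iInf_top]

lemma smallSimplicialChains_eq_full (hU : IsInteriorCover U) {J : Interval}
    (hJ : J = .Jone ∨ J = .Jplus) :
    smallSimplicialChains J U = Subcomplex.full (simplicialChains J X) := by
  apply Subcomplex.ext
  funext n
  refine (AddSubgroup.eq_top_iff' _).2
    ((isFreeBasis_simplexChain J n).mem_of_forall _ fun σ => IsSmall.simplexChain_mem ?_)
  obtain ⟨x, hx⟩ := exists_nhd_simp_eq_top hJ n
  exact isSmall_of_nhd_eq_top hU hx σ.cont

lemma smallCubicalChains_eq_full (hU : IsInteriorCover U) {J : Interval}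
    (hJ : J = .Jone ∨ J = .Jplus) :
    smallCubicalChains J U = Subcomplex.full (cubicalChains J X) := by
  apply Subcomplex.ext
  funext n
  refine (AddSubgroup.eq_top_iff' _).2 fun x => ?_
  obtain ⟨x, rfl⟩ := QuotientAddGroup.mk_surjective x
  refine AddSubgroup.mem_map_of_mem (QuotientAddGroup.mk' ((degenerateChains J X).carrier n)) ?_
  refine (isFreeBasis_cubeChain J n).mem_of_forall _ (fun σ => AddSubgroup.subset_closure ?_) x
  obtain ⟨x, hx⟩ := exists_nhd_cube_eq_top hJ n
  exact ⟨σ, isSmall_of_nhd_eq_top hU hx σ.cont, rfl⟩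

end Discrete

end CechClosure

/-! ### Assembly of the discrete and the topological cases -/

theorem mainTheorem6 {X : Type u} [CechClosure.ClosureSpace X] {ι : Type v} (U : ι → Set X)
    (hU : CechClosure.ClosureSpace.IsInteriorCover U) :
    (∀ J : CechClosure.Interval,
      (∃ e : HomotopyEquiv (CechClosure.smallSimplicialChains J U).toComplex
          (CechClosure.simplicialChains J X),
        e.hom = (CechClosure.smallSimplicialChains J U).incl) ∧
      (∃ e : HomotopyEquiv (CechClosure.smallCubicalChains J U).toComplex
          (CechClosure.cubicalChains J X),
        e.hom = (CechClosure.smallCubicalChains J U).incl)) ∧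
    (∀ J : CechClosure.Interval, J = .Jone ∨ J = .Jplus →
      CechClosure.smallSimplicialChains J U =
          CechClosure.Subcomplex.full (CechClosure.simplicialChains J X) ∧
        CechClosure.smallCubicalChains J U =
          CechClosure.Subcomplex.full (CechClosure.cubicalChains J X)) := by
  have hdisc : ∀ J : CechClosure.Interval, J = .Jone ∨ J = .Jplus →
      CechClosure.smallSimplicialChains J U =
          CechClosure.Subcomplex.full (CechClosure.simplicialChains J X) ∧
        CechClosure.smallCubicalChains J U =
          CechClosure.Subcomplex.full (CechClosure.cubicalChains J X) := fun J hJ =>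
    ⟨CechClosure.smallSimplicialChains_eq_full hU hJ, CechClosure.smallCubicalChains_eq_full hU hJ⟩
  refine ⟨fun J => ?_, hdisc⟩
  by_cases hJ : J = .Jone ∨ J = .Jplus
  · obtain ⟨h1, h2⟩ := hdisc J hJ
    -- The inclusion of the full subcomplex still has to be exhibited as a homotopy equivalence; the
    -- zero deformation does this.
    exact ⟨⟨(CechClosure.Deformation.ofEqTop fun n => by rw [h1]; rfl).homotopyEquiv, rfl⟩,
      ⟨(CechClosure.Deformation.ofEqTop fun n => by rw [h2]; rfl).homotopyEquiv, rfl⟩⟩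
  · obtain rfl : J = .I := by
      cases J
      · rfl
      · exact (hJ (Or.inr rfl)).elim
      · exact (hJ (Or.inl rfl)).elim
    obtain ⟨h1⟩ := CechClosure.nonempty_deformation_smallSimplicialChains hU
    obtain ⟨h2⟩ := CechClosure.nonempty_deformation_smallCubicalChains hU
    exact ⟨⟨h1.homotopyEquiv, rfl⟩, ⟨h2.homotopyEquiv, rfl⟩⟩
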